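/- Let $G=(V,E)$ be a finite connected graph embedded in the plane, with set of faces $U$ and unbounded face $\mathfrak g\in U$, let $\beta>0$ and let $J_e>0$ $(e\in E)$ be coupling constants. Let $G^*=(U,E^*)$ be the full dual graph, $e^*$ the edge dual to $e$, and let $\beta^*$, $J^*_{e^*}$ satisfy $\exp(-2\beta^*J^*_{e^*})=\tanh(\beta J_e)$ for all $e\in E$. *Double random current.* A current on $G$ is a map $\mathbf n:E\to\{0,1,2,\dots\}$; it is sourceless if the sum of its values around each vertex is even. The random current on $G$ gives each sourceless $\mathbf n$ a probability proportional to $\prod_{e}(\beta J_e)^{\mathbf n_e}/\mathbf n_e!$; the double random current (with free boundary conditions) is the sum of two independent random currents. The clusters of $\mathbf n$ are the connected components of $(V,\{e:\mathbf n_e>0\})$, isolated vertices included. The same definitions apply to $G^*$ with $\beta^*,J^*$; this is the dual double random current (wired boundary conditions on the weak dual graph, with ghost vertex $\mathfrak g$). Denote by $\mathcal C_{\mathfrak g}$ the cluster of $\mathfrak g$ in a current on $G^*$. *Nesting fields.* For a cluster $\mathcal C$ of a sourceless current, consider the $\pm1$ spin configuration on the faces that is $+1$ at the external face and changes exactly across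 the edges of $\mathcal C$ with odd current; $\mathcal C$ is odd around a face if the spin of this face is $-1$. Given signs $\epsilon_{\mathcal C}=\pm1$ (labels) of the clusters, the free nesting field on the faces $u$ of $G$ (external face $\mathfrak g$) is $h(u)=\sum_{\mathcal C}\mathbf 1\{\mathcal C\text{ odd around }u\}\,\epsilon_{\mathcal C}$. The faces of $G^*$ are the vertices of $G$; fix as external face of $G^*$ any vertex $v_0\in V$ incident on $\mathfrak g$. The wired nesting field is $$h^+_{v_0}(v)=\bigl(\tfrac12-\mathbf 1\{\mathcal C_{\mathfrak g}\text{ odd around }v\}\bigr)\epsilon_{\mathcal C_{\mathfrak g}}+\sum_{\mathcal C\ne\mathcal C_{\mathfrak g}}\mathbf 1\{\mathcal C\text{ odd around }v\}\,\epsilon_{\mathcal C},\qquad v\in V.$$ The laws of these fields are taken with labels that are i.i.d. uniform on $\{\pm1\}$ given the current. **Theorem.** One can couple (i) the double random current $\mathbf n$ on $G$ together with spins $(\tau_{\mathcal C})$ of its clusters that are i.i.d. uniform on $\{\pm1\}$ given $\mathbf n$, (ii) the dual double random current $\mathbf n^\dagger$ on $G^*$ together with spins $(\tau^\dagger_{\mathcal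 C})$ of its clusters that are i.i.d. uniform on $\{\pm1\}$ given $\mathbf n^\dagger$, and (iii) a function $H:V\cup U\to\mathbb R$, so that the following holds almost surely, where $\tau_v$ (resp. $\tau^\dagger_u$) is the spin of the cluster of $v\in V$ (resp. $u\in U$). 1. $\mathbf n_e$ is odd if and only if $\tau^\dagger$ differs on the two sides of $e$; $\mathbf n^\dagger_{e^*}$ is odd if and only if $\tau$ differs at the two ends of $e$. 2. $H(u)-H(v)=\tfrac12\tau^\dagger_u\tau_v$ for every face $u$ and every vertex $v$ incident on $u$. Every cluster $\mathcal C$ of $\mathbf n$ has a well-defined dual spin $\tau^\dagger_{\mathcal C}$, the common value of $\tau^\dagger$ at the faces that are incident on $\mathcal C$ and lie in the component of the complement of $\mathcal C$ containing $\mathfrak g$ (there is at least one such face). Likewise every cluster $\mathcal C\neq\mathcal C_{\mathfrak g}$ of $\mathbf n^\dagger$ has a well-defined dual spin $\tau_{\mathcal C}$, with $v_0$ in place of $\mathfrak g$. Put $\tau_{\mathcal C_{\mathfrak g}}=+1$ and $\epsilon_{\mathcal C}=\tau_{\mathcal C}\tau^\dagger_{\mathcal C}$ for the clusters of $\mathbf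 n$ and of $\mathbf n^\dagger$. - Given $\mathbf n$, the labels $\epsilon_{\mathcal C}$ of its clusters are i.i.d. uniform; $(\mathbf n,H|_U)$ has the law of $\mathbf n$ together with its free nesting field; and $H|_U=-h$ for the labels $\epsilon_{\mathcal C}$. - For every $v_0\in V$ incident on $\mathfrak g$: given $\mathbf n^\dagger$, the labels $\epsilon_{\mathcal C}$ of its clusters are i.i.d. uniform; $(\mathbf n^\dagger,H|_V)$ has the law of $\mathbf n^\dagger$ together with its wired nesting field $h^+_{v_0}$; and $H|_V=h^+_{v_0}$ for the labels $\epsilon_{\mathcal C}$, except that the label of $\mathcal C_{\mathfrak g}$ is multiplied by $-\tau_{v_0}$. 3. $\mathbf n_e>0$ implies $\mathbf n^\dagger_{e^*}=0$, and $\mathbf n^\dagger_{e^*}>0$ implies $\mathbf n_e=0$. -/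

import Mathlib

open scoped ENNReal

noncomputable section

/-- Darts: every edge `e` carries two darts `(e, true)` and `(e, false)`, its two orientations.
`dartRev` reverses the orientation. -/
def dartRev (E : Type*) : Equiv.Perm (E × Bool) :=
  (Equiv.refl E).prodCongr Equiv.boolNot

/-- A connected graph with vertex set `V` and edge set `E`, embedded in the sphere with set of
faces `U`, given by its rotation system (parallel edges and loops are allowed).

* `rot d` is the dart following `d` in counterclockwise order around the vertex from which `d`
  emanates.
* `tail d` is the vertex from which `d` emanates; the darts emanating from one vertex form one
  cycle of `rot`.
* `left d` is the face lying to the left of `d`. If one walks along `d` keeping this face on the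
  left, the next dart is `rot⁻¹ (dartRev E d)`; the darts with one face on their left form one
  cycle of `rot⁻¹ * dartRev E`.
* `transitive` says that the graph is connected.
* `euler` is Euler's formula, which says that the surface is the sphere.

If there is no edge then the graph is one vertex in the sphere, with one face. -/
structure PlaneGraph (V E U : Type*) where
  rot : Equiv.Perm (E × Bool)
  tail : E × Bool → V
  left : E × Bool → U
  nonempty_vertex : Nonempty V
  nonempty_face : Nonempty U
  tail_surjective : Nonempty E → Function.Surjective tail
  left_surjective : Nonempty E → Function.Surjective left
  tail_eq_iff : ∀ d d', tail d = tail d' ↔ rot.SameCycle d d'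
  left_eq_iff : ∀ d d', left d = left d' ↔ (rot⁻¹ * dartRev E).SameCycle d d'
  transitive : ∀ d d', ∃ p ∈ Subgroup.closure {rot, dartRev E}, p d = d'
  euler : Nat.card V + Nat.card U = Nat.card E + 2

namespace PlaneGraph

variable {V E U : Type*}

@[simp]
theorem dartRev_mul_self : dartRev E * dartRev E = 1 := by
  ext ⟨e, b⟩ <;> simp [dartRev]

@[simp]
theorem dartRev_inv : (dartRev E)⁻¹ = dartRev E :=
  inv_eq_of_mul_eq_one_left dartRev_mul_self

@[simp]
theorem dartRev_dartRev (d : E × Bool) : dartRev E (dartRev E d) = d :=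
  congrArg (fun p : Equiv.Perm (E × Bool) => p d) dartRev_mul_self

/-- The (full) dual graph: its vertices are the faces of `G`, its faces are the vertices of `G`,
and the edge dual to `e` is again called `e`. The dual of the dart `d` crosses `d` from its right
side to its left side. -/
def dual (G : PlaneGraph V E U) : PlaneGraph U E V where
  rot := dartRev E * G.rot⁻¹
  tail d := G.left (dartRev E d)
  left := G.tail
  nonempty_vertex := G.nonempty_face
  nonempty_face := G.nonempty_vertex
  tail_surjective h u := by
    obtain ⟨d, hd⟩ := G.left_surjective h u
    exact ⟨dartRev E d, by simpa using hd⟩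
  left_surjective := G.tail_surjective
  tail_eq_iff d d' := by
    rw [G.left_eq_iff]
    have h : dartRev E * G.rot⁻¹ =
        dartRev E * (G.rot⁻¹ * dartRev E) * (dartRev E)⁻¹ := by
      simp [mul_assoc]
    rw [h, Equiv.Perm.sameCycle_conj, dartRev_inv]
  left_eq_iff d d' := by
    rw [G.tail_eq_iff]
    simp [mul_inv_rev, mul_assoc]
  transitive d d' := by
    obtain ⟨p, hp, h⟩ := G.transitive d d'
    refine ⟨p, (Subgroup.closure_le _).2 ?_ hp, h⟩
    have h2 : dartRev E ∈ Subgroup.closure {dartRev E * G.rot⁻¹, dartRev E} :=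
      Subgroup.subset_closure (by simp)
    have h1 : dartRev E * G.rot⁻¹ ∈ Subgroup.closure {dartRev E * G.rot⁻¹, dartRev E} :=
      Subgroup.subset_closure (by simp)
    rintro q (rfl | rfl)
    · have := mul_mem (inv_mem h1) h2
      simpa [mul_assoc] using this
    · exact h2
  euler := by rw [add_comm]; exact G.euler

/-- The vertex `v` and the face `u` are incident: some corner of `u` is at `v`. -/
def Incident (G : PlaneGraph V E U) (v : V) (u : U) : Prop :=
  (∃ d, G.tail d = v ∧ G.left d = u) ∨ IsEmpty E

section Current

variable [Fintype E]

open Classical in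
/-- A current is sourceless if the sum of its values around every vertex is even
(a loop counts twice at its vertex). -/
def Sourceless (G : PlaneGraph V E U) (n : E → ℕ) : Prop :=
  ∀ v, Even (∑ d with G.tail d = v, n d.1)

/-- The weight of a current at inverse temperature `β` with coupling constants `J`. -/
def currentWeight (β : ℝ) (J : E → ℝ) (n : E → ℕ) : ℝ :=
  ∏ e, (β * J e) ^ n e / (n e).factorial

open Classical in
/-- The weights of sourceless currents, extended by zero to all currents. -/
def sourcelessWeight (G : PlaneGraph V E U) (β : ℝ) (J : E → ℝ) (n : E → ℕ) : ℝ≥0∞ :=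
  if G.Sourceless n then ENNReal.ofReal (currentWeight β J n) else 0

theorem tsum_sourcelessWeight_ne_zero (G : PlaneGraph V E U) (β : ℝ) (J : E → ℝ) :
    ∑' n, G.sourcelessWeight β J n ≠ 0 := by
  intro h
  have h0 := ENNReal.tsum_eq_zero.1 h 0
  simp [sourcelessWeight, Sourceless, currentWeight] at h0

theorem tsum_sourcelessWeight_ne_top (G : PlaneGraph V E U) (β : ℝ) (J : E → ℝ) :
    ∑' n, G.sourcelessWeight β J n ≠ ∞ := by
  classical
  refine ne_top_of_le_ne_top
    (ENNReal.ofReal_ne_top (r := ∏ e, Real.exp |β * J e|)) ?_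
  rw [ENNReal.tsum_eq_iSup_sum]
  refine iSup_le fun S => ?_
  calc ∑ n ∈ S, G.sourcelessWeight β J n
      ≤ ∑ n ∈ S, ENNReal.ofReal (∏ e, |β * J e| ^ n e / (n e).factorial) := by
        refine Finset.sum_le_sum fun n _ => ?_
        unfold sourcelessWeight
        split_ifs
        · refine ENNReal.ofReal_le_ofReal ((le_abs_self _).trans (le_of_eq ?_))
          simp [currentWeight, Finset.abs_prod, abs_div, abs_pow]
        · exact zero_le
    _ = ENNReal.ofReal (∑ n ∈ S, ∏ e, |β * J e| ^ n e / (n e).factorial) := by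
        rw [ENNReal.ofReal_sum_of_nonneg]
        intro n _
        positivity
    _ ≤ ENNReal.ofReal (∏ e, Real.exp |β * J e|) := by
        refine ENNReal.ofReal_le_ofReal ?_
        let N := (S.sup fun n => ∑ e, n e) + 1
        have hS : S ⊆ Fintype.piFinset fun _ : E => Finset.range N := by
          intro n hn
          rw [Fintype.mem_piFinset]
          intro e
          rw [Finset.mem_range]
          have h1 : n e ≤ ∑ e, n e :=
            Finset.single_le_sum (fun _ _ => Nat.zero_le _) (Finset.mem_univ e)
          have h2 : (∑ e, n e) ≤ S.sup fun n => ∑ e, n e :=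
            Finset.le_sup (f := fun n : E → ℕ => ∑ e, n e) hn
          omega
        refine (Finset.sum_le_sum_of_subset_of_nonneg hS
          fun n _ _ => by positivity).trans ?_
        rw [← Finset.prod_univ_sum (fun _ => Finset.range N)
          (fun e k => |β * J e| ^ k / (k.factorial : ℝ))]
        exact Finset.prod_le_prod (fun e _ => Finset.sum_nonneg fun k _ => by positivity)
          fun e _ => Real.sum_le_exp_of_nonneg (abs_nonneg _) N

/-- The law of the sourceless random current: the probability of a sourceless current `n` is
proportional to `currentWeight β J n`. -/
def currentLaw (G : PlaneGraph V E U) (β : ℝ) (J : E → ℝ) : PMF (E → ℕ) :=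
  PMF.normalize (G.sourcelessWeight β J) (G.tsum_sourcelessWeight_ne_zero β J)
    (G.tsum_sourcelessWeight_ne_top β J)

/-- The law of the double random current with free boundary conditions: the sum of two
independent sourceless random currents. -/
def doubleCurrentLaw (G : PlaneGraph V E U) (β : ℝ) (J : E → ℝ) : PMF (E → ℕ) :=
  (G.currentLaw β J).bind fun n₁ => (G.currentLaw β J).map fun n₂ => n₁ + n₂

end Current

/-- The graph on `V` whose edges are those with nonzero current. -/
def openGraph (G : PlaneGraph V E U) (n : E → ℕ) : SimpleGraph V :=
  SimpleGraph.fromRel fun v w => ∃ d, G.tail d = v ∧ G.tail (dartRev E d) = w ∧ 0 < n d.1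

/-- The clusters of a current; isolated vertices are clusters too. -/
abbrev Cluster (G : PlaneGraph V E U) (n : E → ℕ) : Type _ :=
  (G.openGraph n).ConnectedComponent

/-- The cluster of a vertex. -/
abbrev clusterOf (G : PlaneGraph V E U) (n : E → ℕ) (v : V) : G.Cluster n :=
  (G.openGraph n).connectedComponentMk v

/-- A current together with a sign for each of its clusters. -/
abbrev LabelledCurrent (G : PlaneGraph V E U) : Type _ :=
  Σ n : E → ℕ, (G.Cluster n → ℤˣ)

/-- The spin configuration on the vertices of a labelled current: each vertex has the sign of
its cluster. -/
def LabelledCurrent.spin {G : PlaneGraph V E U} (X : G.LabelledCurrent) (v : V) : ℤˣ :=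
  X.2 (G.clusterOf X.1 v)

section Label

variable [Fintype V]

instance (G : PlaneGraph V E U) (n : E → ℕ) : Fintype (G.Cluster n) :=
  Fintype.ofFinite _

instance (G : PlaneGraph V E U) (n : E → ℕ) : DecidableEq (G.Cluster n) :=
  Classical.decEq _

/-- The law of the double random current with free boundary conditions together with signs of
its clusters that are, given the current, independent and uniform. -/
def labelledDoubleCurrentLaw [Fintype E] (G : PlaneGraph V E U) (β : ℝ) (J : E → ℝ) :
    PMF G.LabelledCurrent :=
  (G.doubleCurrentLaw β J).bind fun n =>
    (PMF.uniformOfFintype (G.Cluster n → ℤˣ)).map (Sigma.mk n)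

end Label

/-- The interfaces of a spin configuration on the faces: the edges across which it changes. -/
def interfaces (G : PlaneGraph V E U) (s : U → ℤˣ) : Set E :=
  {e | s (G.left (e, true)) ≠ s (G.left (e, false))}

/-- The edges belonging to the cluster `C`: nonzero current and endpoints in `C`. -/
def clusterEdges (G : PlaneGraph V E U) (n : E → ℕ) (C : G.Cluster n) : Set E :=
  {e | 0 < n e ∧ G.clusterOf n (G.tail (e, true)) = C}

/-- The cluster `C` is odd around the face `u`, where `o` is the external face: the spin
configuration on the faces that is `+1` at `o` and has as interfaces the edges of `C` with odd
current is `-1` at `u`. -/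
def OddAround (G : PlaneGraph V E U) (o : U) (n : E → ℕ) (C : G.Cluster n) (u : U) : Prop :=
  ∃ s : U → ℤˣ, s o = 1 ∧ G.interfaces s = {e ∈ G.clusterEdges n C | Odd (n e)} ∧ s u = -1

section NestingField

variable [Fintype V]

open Classical in
/-- The nesting field with free boundary conditions, where `o` is the external face. -/
def nestingField (G : PlaneGraph V E U) (o : U) (X : G.LabelledCurrent) (u : U) : ℝ :=
  ∑ C : G.Cluster X.1, if G.OddAround o X.1 C u then ((X.2 C : ℤ) : ℝ) else 0

open Classical in
/-- The nesting field with wired boundary conditions, where `g` is the ghost vertex and `o` is the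
external face. -/
def wiredNestingField (G : PlaneGraph V E U) (g : V) (o : U) (X : G.LabelledCurrent) (u : U) : ℝ :=
  (1 / 2 - if G.OddAround o X.1 (G.clusterOf X.1 g) u then 1 else 0) *
      ((X.2 (G.clusterOf X.1 g) : ℤ) : ℝ) +
    ∑ C : G.Cluster X.1 with C ≠ G.clusterOf X.1 g,
      if G.OddAround o X.1 C u then ((X.2 C : ℤ) : ℝ) else 0

end NestingField

/-- Two faces are joined if they are the two sides of an edge not in the cluster `C`. The
components of this graph are the components of the complement of `C` in the sphere. -/
def complementGraph (G : PlaneGraph V E U) (n : E → ℕ) (C : G.Cluster n) : SimpleGraph U :=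
  SimpleGraph.fromRel fun u u' =>
    ∃ d, G.left d = u ∧ G.left (dartRev E d) = u' ∧ d.1 ∉ G.clusterEdges n C

/-- The face `u` is incident on the cluster `C` from the outside: it has a vertex of `C` on its
boundary and is in the component of the complement of `C` that contains the external face `o`. -/
def IncidentOutside (G : PlaneGraph V E U) (o : U) (n : E → ℕ) (C : G.Cluster n) (u : U) : Prop :=
  (∃ v, G.clusterOf n v = C ∧ G.Incident v u) ∧ (G.complementGraph n C).Reachable o u

open Classical in
/-- The spin that `s` assigns to a face incident on the cluster `C` from the outside. -/
def outerSpin (G : PlaneGraph V E U) (o : U) (n : E → ℕ) (s : U → ℤˣ) (C : G.Cluster n) : ℤˣ :=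
  if h : ∃ u, G.IncidentOutside o n C u then s h.choose else 1

/-- The same current with the sign of each cluster multiplied by the spin that `s` assigns to the
faces incident on the cluster from the outside. -/
def twist (G : PlaneGraph V E U) (o : U) (s : U → ℤˣ) (X : G.LabelledCurrent) :
    G.LabelledCurrent :=
  ⟨X.1, fun C => X.2 C * G.outerSpin o X.1 s C⟩

open Classical in
/-- As `twist`, except that the sign of the cluster of the ghost vertex `g` is multiplied
by `a`. -/
def wiredTwist (G : PlaneGraph V E U) (g : V) (a : ℤˣ) (o : U) (s : U → ℤˣ)
    (X : G.LabelledCurrent) : G.LabelledCurrent :=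
  ⟨X.1, fun C => X.2 C * if C = G.clusterOf X.1 g then a else G.outerSpin o X.1 s C⟩

end PlaneGraph

end

/-! ### Corners, connectedness and interfaces -/

noncomputable section

namespace PlaneGraph

variable {V E U : Type*}

/-! Give vertex spins `σ`, face spins `s` and currents `n`, `m` on primal and dual edges a joint
weight that is a product over edges. Summed over `m`, the edge factor is `a ^ k / k!` with `a =
2βJ`, under two constraints: `k` is odd iff `s` changes across the edge, and `k = 0` if `σ` changes
along it. Summed over `n` it is the dual factor with `b = 2β*J*`, up to a constant. Such an edge
coupling exists since Kramers–Wannier duality reads `sinh a * sinh b = 1`, and it can be supported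
on pairs where one current vanishes (`exists_edge_coupling`).

Given `n`, the first marginal makes `σ` constant on clusters and otherwise free, and fixes `s` up to
a global sign. This is the labelled double current: a pair of sourceless currents with sum `n` is an
even subgraph of the multigraph `n`, and counting these (`sum_choose_sourceless`) gives a factor `2
^ (|n| + #clusters - |V|)`. The cluster part cancels the probability of a labelling and `2 ^ |n|`
doubles `β`. As the law is uniform in the cluster spins, multiplying them by signs that depend on
`(n, s)` preserves it (`map_eq_labelledDoubleCurrentLaw`); hence the twisted labels are again i.i.d.

Planarity enters through Euler's formula: even edge sets are exactly the interfaces of face spins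
(`exists_interfaces_eq`). Across an odd edge only the indicator of its own cluster changes, so the
nesting fields have explicit increments (`nestingField_sub`). These make the height relation
propagate from corner to corner (`nestingField_corner`). -/

theorem left_rot_inv (G : PlaneGraph V E U) (d : E × Bool) :
    G.left (G.rot⁻¹ d) = G.left (dartRev E d) :=
  ((G.left_eq_iff (dartRev E d) (G.rot⁻¹ d)).2 ⟨1, by simp⟩).symm

theorem tail_rot_inv (G : PlaneGraph V E U) (d : E × Bool) :
    G.tail (G.rot⁻¹ d) = G.tail d :=
  ((G.tail_eq_iff d (G.rot⁻¹ d)).2 ⟨-1, by simp⟩).symm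

/-- A dart `d` stands for the corner of `left d` at `tail d`. Applying `rot⁻¹` turns about the
vertex by crossing the edge; reversing first instead follows the edge to its other end, keeping the
face. -/
theorem left_rot_inv_rev (G : PlaneGraph V E U) (d : E × Bool) :
    G.left (G.rot⁻¹ (dartRev E d)) = G.left d := by
  rw [left_rot_inv, dartRev_dartRev]

@[simp]
theorem dual_tail (G : PlaneGraph V E U) (d : E × Bool) :
    G.dual.tail d = G.left (dartRev E d) := rfl

@[simp]
theorem dual_left (G : PlaneGraph V E U) (d : E × Bool) : G.dual.left d = G.tail d := rfl

/-- A function of the darts that is invariant under `rot⁻¹` and under reversal is constant. -/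
theorem eq_of_dart_invariant (G : PlaneGraph V E U) {α : Type*} (F : E × Bool → α)
    (hrot : ∀ d, F (G.rot⁻¹ d) = F d) (hrev : ∀ d, F (dartRev E d) = F d) (d d' : E × Bool) :
    F d = F d' := by
  obtain ⟨p, hp, rfl⟩ := G.transitive d d'
  suffices h : ∀ d, F (p d) = F d from (h d).symm
  induction hp using Subgroup.closure_induction with
  | mem q hq =>
    rcases hq with rfl | rfl
    · intro d
      have := hrot (G.rot d)
      simpa using this.symm
    · exact hrev
  | one => simp
  | mul p q _ _ hp hq => intro d; rw [Equiv.Perm.mul_apply, hp, hq]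
  | inv p _ hp =>
    intro d
    have := hp (p⁻¹ d)
    simpa using this.symm

theorem subsingleton_of_isEmpty (G : PlaneGraph V E U) [Finite V] [Finite U] [IsEmpty E] :
    Subsingleton V ∧ Subsingleton U := by
  have := G.nonempty_vertex
  have := G.nonempty_face
  have h := G.euler
  have h1 : 0 < Nat.card V := Nat.card_pos
  have h2 : 0 < Nat.card U := Nat.card_pos
  have h3 : Nat.card E = 0 := Nat.card_of_isEmpty
  exact ⟨Finite.card_le_one_iff_subsingleton.1 (by omega),
    Finite.card_le_one_iff_subsingleton.1 (by omega)⟩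

/-- A function of the vertices that takes equal values at the ends of every edge is constant. -/
theorem eq_of_tail_invariant (G : PlaneGraph V E U) [Finite V] [Finite U] {α : Type*}
    (F : V → α) (h : ∀ d, F (G.tail d) = F (G.tail (dartRev E d))) (v w : V) : F v = F w := by
  cases isEmpty_or_nonempty E with
  | inl hE =>
    have := G.subsingleton_of_isEmpty.1
    rw [Subsingleton.elim v w]
  | inr hE =>
    obtain ⟨d, rfl⟩ := G.tail_surjective hE v
    obtain ⟨d', rfl⟩ := G.tail_surjective hE w
    exact G.eq_of_dart_invariant (fun d => F (G.tail d)) (fun d => by simp only [tail_rot_inv])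
      (fun d => (h d).symm) d d'

/-- A function of the faces that takes equal values on both sides of every edge is constant. -/
theorem eq_of_left_invariant (G : PlaneGraph V E U) [Finite V] [Finite U] {α : Type*}
    (F : U → α) (h : ∀ d, F (G.left d) = F (G.left (dartRev E d))) (u w : U) : F u = F w :=
  G.dual.eq_of_tail_invariant F (fun d => by simpa using (h d).symm) u w

theorem mem_interfaces_iff (G : PlaneGraph V E U) (s : U → ℤˣ) (d : E × Bool) :
    d.1 ∈ G.interfaces s ↔ s (G.left d) ≠ s (G.left (dartRev E d)) := by
  obtain ⟨e, b⟩ := d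
  cases b <;> simp [interfaces, dartRev, ne_comm]

/-- The product `s * t` is unchanged across every edge, hence constant, and it is `1` at `o`. -/
theorem eq_of_interfaces_eq (G : PlaneGraph V E U) [Finite V] [Finite U] {s t : U → ℤˣ} {o : U}
    (h : G.interfaces s = G.interfaces t) (ho : s o = t o) : s = t := by
  have key : ∀ u, s u * t u = s o * t o := by
    intro u
    refine G.eq_of_left_invariant (fun u => s u * t u) (fun d => ?_) u o
    have h1 := G.mem_interfaces_iff s d
    have h2 := G.mem_interfaces_iff t d
    rw [h] at h1
    by_cases hd : d.1 ∈ G.interfaces t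
    · have h3 := Int.units_ne_iff_eq_neg.1 (h1.1 hd)
      have h4 := Int.units_ne_iff_eq_neg.1 (h2.1 hd)
      simp only [h3, h4, neg_mul_neg]
    · have h3 := not_not.1 (mt h1.2 hd)
      have h4 := not_not.1 (mt h2.2 hd)
      simp only [h3, h4]
  funext u
  have := key u
  rw [ho, Int.units_mul_self] at this
  rw [← mul_one (t u), ← this]
  rw [mul_left_comm, Int.units_mul_self, mul_one]

/-- The double dual is `G` with every dart reversed, and interfaces do not see orientation. -/
theorem dual_dual_interfaces (G : PlaneGraph V E U) (s : U → ℤˣ) :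
    G.dual.dual.interfaces s = G.interfaces s := by
  ext e
  simp [interfaces, dartRev, ne_comm]

section Cluster

theorem clusterOf_rev (G : PlaneGraph V E U) {n : E → ℕ} {d : E × Bool} (h : 0 < n d.1) :
    G.clusterOf n (G.tail (dartRev E d)) = G.clusterOf n (G.tail d) := by
  by_cases hv : G.tail d = G.tail (dartRev E d)
  · rw [hv]
  · refine (SimpleGraph.ConnectedComponent.sound (SimpleGraph.Adj.reachable ?_)).symm
    exact (SimpleGraph.fromRel_adj _ _ _).2 ⟨hv, Or.inl ⟨d, rfl, rfl, h⟩⟩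

theorem of_clusterOf_eq (G : PlaneGraph V E U) {n : E → ℕ} (P : V → Prop)
    (h : ∀ d, 0 < n d.1 → P (G.tail d) → P (G.tail (dartRev E d))) {v w : V}
    (hvw : G.clusterOf n v = G.clusterOf n w) (hv : P v) : P w := by
  obtain ⟨p⟩ := SimpleGraph.ConnectedComponent.exact hvw
  induction p with
  | nil => exact hv
  | cons hadj p ih =>
    refine ih (SimpleGraph.ConnectedComponent.sound ⟨p⟩) ?_
    obtain ⟨-, ⟨d, rfl, rfl, hd⟩ | ⟨d, rfl, rfl, hd⟩⟩ := (SimpleGraph.fromRel_adj _ _ _).1 hadj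
    · exact h d hd hv
    · simpa using h (dartRev E d) hd hv

theorem eq_of_clusterOf_eq (G : PlaneGraph V E U) {n : E → ℕ} {α : Type*} (F : V → α)
    (h : ∀ d, 0 < n d.1 → F (G.tail (dartRev E d)) = F (G.tail d)) {v w : V}
    (hvw : G.clusterOf n v = G.clusterOf n w) : F v = F w :=
  (G.of_clusterOf_eq (fun x => F x = F v) (fun d hd hx => (h d hd).trans hx) hvw rfl).symm

theorem mem_clusterEdges_iff (G : PlaneGraph V E U) {n : E → ℕ} {C : G.Cluster n}
    (d : E × Bool) :
    d.1 ∈ G.clusterEdges n C ↔ 0 < n d.1 ∧ G.clusterOf n (G.tail d) = C := by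
  obtain ⟨e, b⟩ := d
  refine and_congr_right fun h => ?_
  cases b
  · rw [← G.clusterOf_rev (d := (e, true)) h]
    rfl
  · rfl

/-- A function of the darts that is invariant under `rot⁻¹` at the vertex `v` is constant
there. -/
theorem eq_of_rot_invariant (G : PlaneGraph V E U) [Finite E] {α : Type*} (F : E × Bool → α)
    {v : V} (h : ∀ d, G.tail d = v → F (G.rot⁻¹ d) = F d) {d d' : E × Bool}
    (hd : G.tail d = v) (hd' : G.tail d' = v) : F d = F d' := by
  have hs : (G.rot⁻¹).SameCycle d d' :=
    Equiv.Perm.sameCycle_inv.2 ((G.tail_eq_iff d d').1 (hd.trans hd'.symm))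
  obtain ⟨k, -, -, rfl⟩ := hs.exists_pow_eq''
  clear hs hd'
  have key : ∀ k : ℕ, G.tail ((G.rot⁻¹ ^ k) d) = v ∧ F ((G.rot⁻¹ ^ k) d) = F d := by
    intro k
    induction k with
    | zero => simp [hd]
    | succ k ih =>
      rw [pow_succ', Equiv.Perm.mul_apply]
      exact ⟨(G.tail_rot_inv _).trans ih.1, (h _ ih.1).trans ih.2⟩
  exact (key k).2.symm

end Cluster

/-! ### High-temperature expansion and even subgraphs -/

section Counting

variable [Fintype V] [Fintype E]

theorem sum_units_pow (k : ℕ) : ∑ s : ℤˣ, ((s : ℤ)) ^ k = if Even k then 2 else 0 := by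
  rw [UnitsInt.univ]
  split_ifs with h
  · simp [h]
  · simp [(Nat.not_even_iff_odd.1 h).neg_one_pow]

open Classical in
/-- The indicator of sourceless currents as a sum over spin configurations. -/
theorem sum_spin_prod_pow (G : PlaneGraph V E U) (m : E → ℕ) :
    ∑ σ : V → ℤˣ, ∏ e, ((σ (G.tail (e, true)) * σ (G.tail (e, false)) : ℤˣ) : ℤ) ^ m e =
      if G.Sourceless m then 2 ^ Fintype.card V else 0 := by
  -- Grouping darts by their tail turns the exponent of `σ v` into the degree of `m` at `v`; the sum
  -- over `σ` then factorises over vertices.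
  have h1 : ∀ σ : V → ℤˣ,
      ∏ e, ((σ (G.tail (e, true)) * σ (G.tail (e, false)) : ℤˣ) : ℤ) ^ m e =
        ∏ v, ((σ v : ℤ)) ^ (∑ d with G.tail d = v, m d.1) := by
    intro σ
    calc _ = ∏ d : E × Bool, ((σ (G.tail d) : ℤ)) ^ m d.1 := by
          rw [Fintype.prod_prod_type]
          simp [mul_pow]
      _ = ∏ v, ∏ d with G.tail d = v, ((σ (G.tail d) : ℤ)) ^ m d.1 :=
          (Finset.prod_fiberwise _ _ _).symm
      _ = _ := by
          refine Finset.prod_congr rfl fun v _ => ?_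
          rw [← Finset.prod_pow_eq_pow_sum]
          refine Finset.prod_congr rfl fun d hd => ?_
          rw [(Finset.mem_filter.1 hd).2]
  simp_rw [h1]
  rw [← Fintype.prod_sum fun (v : V) (s : ℤˣ) => ((s : ℤ)) ^ (∑ d with G.tail d = v, m d.1)]
  simp_rw [sum_units_pow, Finset.prod_ite_zero]
  simp only [Finset.mem_univ, forall_const, Finset.prod_const, Finset.card_univ, Sourceless]
  congr

/-- Spin configurations that are constant on clusters. -/
def clusterSpinEquiv (G : PlaneGraph V E U) (n : E → ℕ) :
    (G.Cluster n → ℤˣ) ≃ {σ : V → ℤˣ // ∀ d, 0 < n d.1 → σ (G.tail (dartRev E d)) = σ (G.tail d)}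
    where
  toFun l := ⟨fun v => l (G.clusterOf n v), fun _ hd => congrArg l (G.clusterOf_rev hd)⟩
  invFun σ C := σ.1 C.out
  left_inv l := by
    funext C
    exact congrArg l C.out_eq
  right_inv σ := by
    ext v
    exact congrArg _ (G.eq_of_clusterOf_eq σ.1 σ.2 (Quot.out_eq (G.clusterOf n v)))

open Classical in
/-- The number of sourceless subcurrents of a current, where the current is regarded as a
multigraph. -/
theorem sum_choose_sourceless (G : PlaneGraph V E U) (n : E → ℕ) :
    2 ^ Fintype.card V * (∑ m ∈ Fintype.piFinset fun e => Finset.range (n e + 1),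
        if G.Sourceless m then ∏ e, (n e).choose (m e) else 0) =
      2 ^ (∑ e, n e) * 2 ^ Fintype.card (G.Cluster n) := by
  -- Both sides evaluate the sum over `σ` of `∏ (1 + σσ) ^ n e`. Each factor is `2 ^ n e` or
  -- vanishes, so only `σ` constant on clusters survive; the binomial expansion produces the
  -- sourceless subcurrents.
  have h1 : ∀ σ : V → ℤˣ,
      ∑ m ∈ Fintype.piFinset (fun e => Finset.range (n e + 1)),
        ∏ e, (((σ (G.tail (e, true)) * σ (G.tail (e, false)) : ℤˣ) : ℤ) ^ m e *
          ((n e).choose (m e) : ℤ)) =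
      if ∀ d : E × Bool, 0 < n d.1 → σ (G.tail (dartRev E d)) = σ (G.tail d)
        then 2 ^ (∑ e, n e) else 0 := by
    intro σ
    rw [← Finset.prod_univ_sum (fun e => Finset.range (n e + 1)) (fun e k =>
      ((σ (G.tail (e, true)) * σ (G.tail (e, false)) : ℤˣ) : ℤ) ^ k * ((n e).choose k : ℤ))]
    have h2 : ∀ e, ∑ k ∈ Finset.range (n e + 1),
        ((σ (G.tail (e, true)) * σ (G.tail (e, false)) : ℤˣ) : ℤ) ^ k * ((n e).choose k : ℤ) =
        (((σ (G.tail (e, true)) * σ (G.tail (e, false)) : ℤˣ) : ℤ) + 1) ^ n e := by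
      intro e
      rw [add_pow]
      simp
    simp_rw [h2]
    split_ifs with h
    · rw [← Finset.prod_pow_eq_pow_sum]
      refine Finset.prod_congr rfl fun e _ => ?_
      rcases Nat.eq_zero_or_pos (n e) with h0 | h0
      · simp [h0]
      · have h3 : σ (G.tail (e, false)) = σ (G.tail (e, true)) := h (e, true) h0
        rw [h3, Int.units_mul_self]
        norm_num
    · push Not at h
      obtain ⟨⟨e, b⟩, hd, hne⟩ := h
      refine Finset.prod_eq_zero (Finset.mem_univ e) ?_
      have h3 : σ (G.tail (e, true)) = -σ (G.tail (e, false)) := by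
        refine Int.units_ne_iff_eq_neg.1 ?_
        cases b
        · exact hne
        · exact hne.symm
      rw [h3, neg_mul, Int.units_mul_self]
      simpa using hd.ne'
  have h2 := Finset.sum_congr (s₁ := Finset.univ) rfl fun (σ : V → ℤˣ) _ => h1 σ
  rw [Finset.sum_comm] at h2
  have h3 : ∀ m : E → ℕ, ∑ σ : V → ℤˣ,
      ∏ e, (((σ (G.tail (e, true)) * σ (G.tail (e, false)) : ℤˣ) : ℤ) ^ m e *
          ((n e).choose (m e) : ℤ)) =
      2 ^ Fintype.card V * if G.Sourceless m then ∏ e, ((n e).choose (m e) : ℤ) else 0 := by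
    intro m
    simp_rw [Finset.prod_mul_distrib]
    rw [← Finset.sum_mul, sum_spin_prod_pow]
    split_ifs <;> simp
  simp_rw [h3] at h2
  rw [← Finset.mul_sum, ← Finset.sum_filter (s := Finset.univ) (fun σ : V → ℤˣ =>
    ∀ d : E × Bool, 0 < n d.1 → σ (G.tail (dartRev E d)) = σ (G.tail d)), Finset.sum_const,
    ← Fintype.card_subtype, ← Fintype.card_congr (G.clusterSpinEquiv n), Fintype.card_fun,
    Fintype.card_units_int] at h2
  zify
  rw [h2]
  simp [mul_comm]

end Counting

/-! ### Even edge sets are interfaces, by Euler's formula -/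

section Interfaces

variable [Fintype E]

/-- A current whose odd part is the set of interfaces of spins on the faces is sourceless. -/
theorem sourceless_of_odd_eq_interfaces (G : PlaneGraph V E U) {s : U → ℤˣ} {n : E → ℕ}
    (h : {e | Odd (n e)} = G.interfaces s) : G.Sourceless n := by
  classical
  intro v
  -- The parity at `v` counts the sign changes of `s` in one turn about `v`, so the product over its
  -- darts cancels.
  have h1 : ∀ d : E × Bool, (-1 : ℤˣ) ^ n d.1 = s (G.left d) * s (G.left (G.rot⁻¹ d)) := by
    intro d
    rw [left_rot_inv]
    have h2 := G.mem_interfaces_iff s d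
    rw [← h, Set.mem_ofPred_eq] at h2
    by_cases hd : Odd (n d.1)
    · rw [hd.neg_one_pow, Int.units_ne_iff_eq_neg.1 (h2.1 hd), neg_mul, Int.units_mul_self]
    · rw [(Nat.not_odd_iff_even.1 hd).neg_one_pow, not_not.1 (mt h2.2 hd), Int.units_mul_self]
  have h2 : (-1 : ℤˣ) ^ (∑ d with G.tail d = v, n d.1) = 1 := by
    rw [← Finset.prod_pow_eq_pow_sum]
    simp_rw [h1]
    rw [Finset.prod_mul_distrib]
    have h3 : ∏ d with G.tail d = v, s (G.left (G.rot⁻¹ d)) =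
        ∏ d with G.tail d = v, s (G.left d) := by
      refine Finset.prod_equiv G.rot⁻¹ (fun d => ?_) fun d _ => rfl
      simp only [Finset.mem_filter, Finset.mem_univ, true_and, tail_rot_inv]
    rw [h3, Int.units_mul_self]
  by_contra hodd
  rw [(Nat.not_even_iff_odd.1 hodd).neg_one_pow] at h2
  exact absurd h2 (by decide)

variable [Fintype V] [Fintype U]

omit [Fintype E] in
theorem card_cluster_of_pos (G : PlaneGraph V E U) {n : E → ℕ} (hn : ∀ e, 0 < n e) :
    Fintype.card (G.Cluster n) = 1 := by
  have := G.nonempty_vertex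
  refine Fintype.card_eq_one_iff.2 ⟨G.clusterOf n (Classical.arbitrary V), fun C => ?_⟩
  induction C using SimpleGraph.ConnectedComponent.ind with
  | h v =>
    exact G.eq_of_tail_invariant (G.clusterOf n) (fun d => (G.clusterOf_rev (hn d.1)).symm) _ _

open Classical in
/-- The number of even sets of edges, by Euler's formula. -/
theorem two_mul_card_even (G : PlaneGraph V E U) :
    2 * Finset.card {m ∈ Fintype.piFinset fun _ : E => Finset.range 2 | G.Sourceless m} =
      2 ^ Fintype.card U := by
  -- For the current `1` subcurrents are edge sets and there is one cluster, so the count is `2 ^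
  -- (|E| + 1 - |V|)`.
  have h := G.sum_choose_sourceless fun _ => 1
  rw [G.card_cluster_of_pos fun _ => one_pos] at h
  have h1 : ∀ m ∈ Fintype.piFinset fun _ : E => Finset.range (1 + 1),
      (if G.Sourceless m then ∏ e, Nat.choose 1 (m e) else 0) = if G.Sourceless m then 1 else 0 := by
    intro m hm
    have : ∀ e, Nat.choose 1 (m e) = 1 := by
      intro e
      have := Finset.mem_range.1 (Fintype.mem_piFinset.1 hm e)
      interval_cases m e <;> rfl
    simp [this]
  rw [Finset.sum_congr rfl h1, ← Finset.card_filter] at h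
  have h2 := G.euler
  simp only [Nat.card_eq_fintype_card] at h2
  have h3 : 2 ^ Fintype.card V * 2 ^ Fintype.card U = 2 ^ Fintype.card E * 2 * 2 := by
    rw [← pow_add, h2, pow_add]
    ring
  simp only [Finset.sum_const, Finset.card_univ, smul_eq_mul, mul_one, pow_one] at h
  refine Nat.eq_of_mul_eq_mul_left (pow_pos two_pos (Fintype.card V)) ?_
  rw [h3, ← h]
  ring

open Classical in
/-- The odd part of a sourceless current is the set of interfaces of spins on the faces. -/
theorem exists_interfaces_eq (G : PlaneGraph V E U) {n : E → ℕ} (hn : G.Sourceless n) (o : U) :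
    ∃ t : U → ℤˣ, t o = 1 ∧ G.interfaces t = {e | Odd (n e)} := by
  -- Taking interfaces is injective from the `2 ^ (|U| - 1)` face spins normalised at `o` into the
  -- even edge sets. There are equally many of those, so it is onto.
  let A : Finset (U → ℤˣ) := {t | t o = 1}
  let B := {m ∈ Fintype.piFinset fun _ : E => Finset.range 2 | G.Sourceless m}
  let F : (U → ℤˣ) → E → ℕ := fun t e => if e ∈ G.interfaces t then 1 else 0
  have hF : ∀ t, {e | Odd (F t e)} = G.interfaces t := by
    intro t
    ext e
    by_cases he : e ∈ G.interfaces t <;> simp [F, he]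
  have hFB : ∀ t ∈ A, F t ∈ B := by
    intro t _
    refine Finset.mem_filter.2 ⟨Fintype.mem_piFinset.2 fun e => ?_,
      G.sourceless_of_odd_eq_interfaces (hF t)⟩
    by_cases he : e ∈ G.interfaces t <;> simp [F, he]
  have hinj : Set.InjOn F A := by
    intro t ht t' ht' h
    refine G.eq_of_interfaces_eq (o := o) ?_ ?_
    · rw [← hF t, ← hF t', h]
    · rw [(Finset.mem_filter.1 ht).2, (Finset.mem_filter.1 ht').2]
  have hA : 2 * A.card = 2 ^ Fintype.card U := by
    have h1 : (Finset.univ.filter fun t : U → ℤˣ => ¬ t o = 1).card = A.card := by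
      refine Finset.card_equiv (Equiv.neg _) fun t => ?_
      rcases Int.units_eq_one_or (t o) with h | h <;> simp [A, h]
    have h2 := Finset.card_filter_add_card_filter_not (s := (Finset.univ : Finset (U → ℤˣ)))
      fun t => t o = 1
    rw [h1, Finset.card_univ, Fintype.card_fun, Fintype.card_units_int] at h2
    change A.card + A.card = _ at h2
    omega
  have hAB : A.image F = B := by
    refine Finset.eq_of_subset_of_card_le (Finset.image_subset_iff.2 hFB) ?_
    rw [Finset.card_image_of_injOn hinj]
    have : 2 * B.card = 2 ^ Fintype.card U := G.two_mul_card_even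
    omega
  have hmem : (fun e => n e % 2) ∈ B := by
    refine Finset.mem_filter.2 ⟨Fintype.mem_piFinset.2 fun e => ?_, fun v => ?_⟩
    · exact Finset.mem_range.2 (Nat.mod_lt _ two_pos)
    · have := hn v
      rw [Nat.even_iff] at this ⊢
      rw [← Finset.sum_nat_mod, this]
  rw [← hAB] at hmem
  obtain ⟨t, ht, hFt⟩ := Finset.mem_image.1 hmem
  refine ⟨t, (Finset.mem_filter.1 ht).2, ?_⟩
  rw [← hF t, hFt]
  ext e
  simp [Nat.odd_iff]

open Classical in
/-- The number of spin configurations on the faces with given interfaces. -/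
theorem card_odd_eq_interfaces (G : PlaneGraph V E U) (n : E → ℕ) :
    Finset.card {t : U → ℤˣ | {e | Odd (n e)} = G.interfaces t} =
      if G.Sourceless n then 2 else 0 := by
  split_ifs with h
  · obtain ⟨o⟩ := G.nonempty_face
    obtain ⟨t, ho, ht⟩ := G.exists_interfaces_eq h o
    have h1 : ({t : U → ℤˣ | {e | Odd (n e)} = G.interfaces t} : Finset _) = {t, -t} := by
      ext s
      simp only [Finset.mem_filter, Finset.mem_univ, true_and, Finset.mem_insert,
        Finset.mem_singleton]
      have hneg : G.interfaces (-t) = G.interfaces t := by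
        ext e
        simp [interfaces]
      constructor
      · intro hs
        rcases Int.units_eq_one_or (s o) with h2 | h2
        · exact Or.inl (G.eq_of_interfaces_eq (hs.symm.trans ht.symm) (h2.trans ho.symm))
        · refine Or.inr (G.eq_of_interfaces_eq (o := o) ?_ ?_)
          · rw [← hs, hneg, ht]
          · simp [h2, ho]
      · rintro (rfl | rfl)
        · exact ht.symm
        · rw [hneg, ht]
    rw [h1, Finset.card_pair]
    intro h2
    have := congrFun h2 o
    rw [Pi.neg_apply, ho] at this
    exact absurd this (by decide)
  · rw [Finset.card_eq_zero, Finset.filter_eq_empty_iff]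
    exact fun t _ ht => h (G.sourceless_of_odd_eq_interfaces ht)

end Interfaces

theorem Incident.dual {G : PlaneGraph V E U} {v : V} {u : U} (h : G.Incident v u) :
    G.dual.Incident u v := by
  rcases h with ⟨d, rfl, rfl⟩ | h
  · refine Or.inl ⟨G.rot d, ?_, ?_⟩
    · rw [dual_tail, ← left_rot_inv]
      simp
    · rw [dual_left, ← tail_rot_inv]
      simp
  · exact Or.inr h

theorem exists_incident_face (G : PlaneGraph V E U) (v : V) : ∃ u, G.Incident v u := by
  cases isEmpty_or_nonempty E with
  | inl hE => exact ⟨G.nonempty_face.some, Or.inr hE⟩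
  | inr hE =>
    obtain ⟨d, rfl⟩ := G.tail_surjective hE v
    exact ⟨_, Or.inl ⟨d, rfl, rfl⟩⟩

theorem exists_incident_vertex (G : PlaneGraph V E U) (u : U) : ∃ v, G.Incident v u := by
  cases isEmpty_or_nonempty E with
  | inl hE => exact ⟨G.nonempty_vertex.some, Or.inr hE⟩
  | inr hE =>
    obtain ⟨d, rfl⟩ := G.left_surjective hE u
    exact ⟨_, Or.inl ⟨d, rfl, rfl⟩⟩

/-! ### Face spins around a single cluster -/

section ClusterSpin

variable [Fintype V] [Fintype E] [Fintype U]

/-- All open edges at a vertex lie in the cluster of that vertex, so restricting a sourceless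
current to one cluster keeps it sourceless. -/
theorem exists_cluster_spin (G : PlaneGraph V E U) {n : E → ℕ} (hn : G.Sourceless n) (o : U)
    (C : G.Cluster n) :
    ∃ t : U → ℤˣ, t o = 1 ∧ G.interfaces t = {e ∈ G.clusterEdges n C | Odd (n e)} := by
  classical
  let m : E → ℕ := fun e => if e ∈ G.clusterEdges n C then n e else 0
  have hm : G.Sourceless m := by
    intro v
    by_cases hv : G.clusterOf n v = C
    · convert hn v using 1
      refine Finset.sum_congr (by congr) fun d hd => ?_
      rcases Nat.eq_zero_or_pos (n d.1) with h0 | h0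
      · simp [m, h0]
      · refine if_pos ((G.mem_clusterEdges_iff d).2 ⟨h0, ?_⟩)
        rw [(Finset.mem_filter.1 hd).2, hv]
    · rw [Finset.sum_eq_zero]
      · exact Even.zero
      · intro d hd
        refine if_neg fun h => hv ?_
        rw [← (Finset.mem_filter.1 hd).2]
        exact ((G.mem_clusterEdges_iff d).1 h).2
  obtain ⟨t, ho, ht⟩ := G.exists_interfaces_eq hm o
  refine ⟨t, ho, ?_⟩
  rw [ht]
  ext e
  by_cases he : e ∈ G.clusterEdges n C <;> simp [m, he]

omit [Fintype E] in
-- The configuration quantified in `OddAround` is unique.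
theorem oddAround_iff (G : PlaneGraph V E U) {n : E → ℕ} {o : U} {C : G.Cluster n} {t : U → ℤˣ}
    (ho : t o = 1) (ht : G.interfaces t = {e ∈ G.clusterEdges n C | Odd (n e)}) (u : U) :
    G.OddAround o n C u ↔ t u = -1 := by
  refine ⟨?_, fun h => ⟨t, ho, ht, h⟩⟩
  rintro ⟨t', ho', ht', h⟩
  rwa [G.eq_of_interfaces_eq (ht.trans ht'.symm) (ho.trans ho'.symm)]

/-- Around a cluster, the spins `s` whose interfaces are the odd edges change exactly where the
spins `t` of the cluster do. -/
theorem mul_eq_mul_of_incident (G : PlaneGraph V E U) {n : E → ℕ} {C : G.Cluster n}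
    {s t : U → ℤˣ} (hs : {e | Odd (n e)} = G.interfaces s)
    (ht : G.interfaces t = {e ∈ G.clusterEdges n C | Odd (n e)}) {v v' : V} {u u' : U}
    (hv : G.clusterOf n v = C) (hv' : G.clusterOf n v' = C) (hvu : G.Incident v u)
    (hvu' : G.Incident v' u') : s u * t u = s u' * t u' := by
  cases isEmpty_or_nonempty E with
  | inl hE =>
    have := G.subsingleton_of_isEmpty.2
    rw [Subsingleton.elim u u']
  | inr hE =>
  obtain ⟨d, rfl, rfl⟩ := hvu.resolve_right (not_isEmpty_of_nonempty E)
  obtain ⟨d', hd', rfl⟩ := hvu'.resolve_right (not_isEmpty_of_nonempty E)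
  -- At a vertex of `C`, both `s` and `t` flip across exactly the odd edges, so `F` is constant
  -- there.
  let F : E × Bool → ℤˣ := fun d => s (G.left d) * t (G.left d)
  have hF : ∀ d, G.clusterOf n (G.tail d) = C → F (G.rot⁻¹ d) = F d := by
    intro d hd
    have h1 := G.mem_interfaces_iff s d
    have h2 := G.mem_interfaces_iff t d
    rw [← hs] at h1
    rw [ht] at h2
    simp only [F, left_rot_inv]
    by_cases hodd : Odd (n d.1)
    · have h3 := Int.units_ne_iff_eq_neg.1 (h1.1 hodd)
      have h4 := Int.units_ne_iff_eq_neg.1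
        (h2.1 ⟨(G.mem_clusterEdges_iff d).2 ⟨hodd.pos, hd⟩, hodd⟩)
      rw [h3, h4, neg_mul_neg]
    · have h3 := not_not.1 (mt h1.2 hodd)
      have h4 := not_not.1 (mt h2.2 fun h => hodd h.2)
      rw [h3, h4]
  have hP := G.of_clusterOf_eq (n := n)
    (fun v => G.clusterOf n v = C ∧ ∀ d', G.tail d' = v → F d' = F d) (v := G.tail d) (w := v')
    ?_ (hv.trans hv'.symm) ⟨hv, ?_⟩
  · exact (hP.2 d' hd').symm
  · rintro d₁ hpos ⟨h1, h2⟩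
    have h3 : G.clusterOf n (G.tail (dartRev E d₁)) = C := (G.clusterOf_rev hpos).trans h1
    refine ⟨h3, fun d₂ hd₂ => ?_⟩
    rw [← h2 d₁ rfl]
    -- Following an open edge to its other end along the same face carries the value of `F` to the
    -- next vertex of `C`.
    have h4 : F (G.rot⁻¹ (dartRev E d₁)) = F d₁ := by
      simp only [F, left_rot_inv_rev]
    rw [← h4]
    refine G.eq_of_rot_invariant F (v := G.tail (dartRev E d₁)) (fun d hd => hF d ?_) hd₂
      (G.tail_rot_inv _)
    rw [hd, h3]
  · intro d' hd'
    exact G.eq_of_rot_invariant F (fun d₁ hd₁ => hF d₁ (hd₁ ▸ hv)) hd' rfl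

omit [Fintype E] in
-- Otherwise no face reached from `o` would border an edge of `C`, so the reached set would be
-- closed under crossing edges and contain every face, including one incident on `C`.
theorem exists_incidentOutside (G : PlaneGraph V E U) (o : U) (n : E → ℕ) (C : G.Cluster n) :
    ∃ u, G.IncidentOutside o n C u := by
  by_contra! h
  have key : ∀ d, (G.complementGraph n C).Reachable o (G.left d) →
      (G.complementGraph n C).Reachable o (G.left (dartRev E d)) := by
    intro d hd
    have hC : d.1 ∉ G.clusterEdges n C := fun hC =>
      h _ ⟨⟨G.tail d, ((G.mem_clusterEdges_iff d).1 hC).2, Or.inl ⟨d, rfl, rfl⟩⟩, hd⟩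
    by_cases heq : G.left d = G.left (dartRev E d)
    · rwa [← heq]
    · exact hd.trans (SimpleGraph.Adj.reachable
        ((SimpleGraph.fromRel_adj _ _ _).2 ⟨heq, Or.inl ⟨d, rfl, rfl, hC⟩⟩))
  induction C using SimpleGraph.ConnectedComponent.ind with
  | h v =>
    obtain ⟨u, hu⟩ := G.exists_incident_face v
    refine h u ⟨⟨v, rfl, hu⟩, ?_⟩
    rw [← G.eq_of_left_invariant (fun u => (G.complementGraph n _).Reachable o u)
      (fun d => propext ⟨key d, fun hd => by simpa using key (dartRev E d) hd⟩) o u]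

omit [Fintype V] [Fintype E] [Fintype U] in
theorem eq_of_complement_reachable (G : PlaneGraph V E U) {n : E → ℕ} {C : G.Cluster n}
    {t : U → ℤˣ} (ht : G.interfaces t = {e ∈ G.clusterEdges n C | Odd (n e)}) {u u' : U}
    (h : (G.complementGraph n C).Reachable u u') : t u = t u' := by
  have key : ∀ d : E × Bool, d.1 ∉ G.clusterEdges n C → t (G.left d) = t (G.left (dartRev E d)) := by
    intro d hd
    by_contra hne
    have := (G.mem_interfaces_iff t d).2 hne
    rw [ht] at this
    exact hd this.1
  obtain ⟨p⟩ := h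
  induction p with
  | nil => rfl
  | cons hadj p ih =>
    rw [← ih]
    obtain ⟨-, ⟨d, rfl, rfl, hd⟩ | ⟨d, rfl, rfl, hd⟩⟩ := (SimpleGraph.fromRel_adj _ _ _).1 hadj
    · exact key d hd
    · exact (key d hd).symm

/-- The outer spin of a cluster, read off at any face incident on the cluster. -/
theorem outerSpin_eq_mul (G : PlaneGraph V E U) {n : E → ℕ} {C : G.Cluster n} {o : U}
    {s t : U → ℤˣ} (hs : {e | Odd (n e)} = G.interfaces s) (ho : t o = 1)
    (ht : G.interfaces t = {e ∈ G.clusterEdges n C | Odd (n e)}) {v : V} {u : U}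
    (hv : G.clusterOf n v = C) (hvu : G.Incident v u) :
    G.outerSpin o n s C = s u * t u := by
  have h := G.exists_incidentOutside o n C
  rw [outerSpin, dif_pos h]
  -- The chosen face is reached from `o` without crossing `C`, so `t = 1` there and its `s` equals
  -- the constant `s * t`.
  obtain ⟨⟨v', hv', hvu'⟩, hr⟩ := h.choose_spec
  have h1 := G.eq_of_complement_reachable ht hr
  rw [G.mul_eq_mul_of_incident hs ht hv hv' hvu hvu', ← h1, ho, mul_one]

theorem outerSpin_eq (G : PlaneGraph V E U) {n : E → ℕ} {C : G.Cluster n} {o : U}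
    {s : U → ℤˣ} (hs : {e | Odd (n e)} = G.interfaces s) {u : U}
    (hu : G.IncidentOutside o n C u) : s u = G.outerSpin o n s C := by
  obtain ⟨t, ho, ht⟩ := G.exists_cluster_spin (G.sourceless_of_odd_eq_interfaces hs) o C
  obtain ⟨⟨v, hv, hvu⟩, hr⟩ := hu
  rw [G.outerSpin_eq_mul hs ho ht hv hvu, ← G.eq_of_complement_reachable ht hr, ho, mul_one]

end ClusterSpin

/-! ### Nesting fields as height functions -/

section Height

variable [Fintype V]

open Classical in
theorem nestingField_mk (G : PlaneGraph V E U) (o : U) (n : E → ℕ) (l : G.Cluster n → ℤˣ)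
    (u : U) :
    G.nestingField o ⟨n, l⟩ u = ∑ C, if G.OddAround o n C u then ((l C : ℤ) : ℝ) else 0 := rfl

open Classical in
theorem wiredNestingField_mk (G : PlaneGraph V E U) (g : V) (o : U) (n : E → ℕ)
    (l : G.Cluster n → ℤˣ) (u : U) :
    G.wiredNestingField g o ⟨n, l⟩ u =
      (1 / 2 - if G.OddAround o n (G.clusterOf n g) u then 1 else 0) *
          ((l (G.clusterOf n g) : ℤ) : ℝ) +
        ∑ C with C ≠ G.clusterOf n g,
          if G.OddAround o n C u then ((l C : ℤ) : ℝ) else 0 := rfl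

omit [Fintype V] in
theorem not_oddAround_self (G : PlaneGraph V E U) (o : U) (n : E → ℕ) (C : G.Cluster n) :
    ¬ G.OddAround o n C o := by
  rintro ⟨t, h1, -, h2⟩
  exact absurd (h1.symm.trans h2) (by decide)

theorem nestingField_self (G : PlaneGraph V E U) (o : U) (X : G.LabelledCurrent) :
    G.nestingField o X o = 0 :=
  Finset.sum_eq_zero fun _ _ => if_neg (G.not_oddAround_self o _ _)

variable [Fintype E] [Fintype U]

/-- The increment of the nesting field across an edge. -/
theorem nestingField_sub (G : PlaneGraph V E U) (X : G.LabelledCurrent) {s : U → ℤˣ}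
    (hs : {e | Odd (X.1 e)} = G.interfaces s) (o : U) (d : E × Bool) :
    G.nestingField o (G.twist o s X) (G.left d) -
        G.nestingField o (G.twist o s X) (G.left (dartRev E d)) =
      -(1 / 2) * (((s (G.left d) : ℤ) : ℝ) - ((s (G.left (dartRev E d)) : ℤ) : ℝ)) *
        ((X.spin (G.tail d) : ℤ) : ℝ) := by
  choose t ho ht using G.exists_cluster_spin (G.sourceless_of_odd_eq_interfaces hs) o
  -- `(1 - t) / 2` is the indicator of oddness.
  have hfield : ∀ u, G.nestingField o (G.twist o s X) u =
      ∑ C : G.Cluster X.1, (1 - ((t C u : ℤ) : ℝ)) / 2 *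
        (((X.2 C * G.outerSpin o X.1 s C : ℤˣ) : ℤ) : ℝ) := by
    intro u
    rw [twist, nestingField_mk]
    refine Finset.sum_congr rfl fun C _ => ?_
    have h := G.oddAround_iff (ho C) (ht C) u
    rcases Int.units_eq_one_or (t C u) with h1 | h1
    · rw [if_neg fun h2 => absurd (h1.symm.trans (h.1 h2)) (by decide), h1]
      simp
    · rw [if_pos (h.2 h1), h1]
      norm_num
  rw [hfield, hfield, ← Finset.sum_sub_distrib]
  have h1 := G.mem_interfaces_iff s d
  rw [← hs] at h1
  by_cases hodd : Odd (X.1 d.1)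
  · have h3 := Int.units_ne_iff_eq_neg.1 (h1.1 hodd)
    -- Only the cluster through the odd edge contributes. Its twisted label is the cluster spin
    -- times `s * t`, and `t * t = 1` leaves the increment of `s`.
    rw [Finset.sum_eq_single (G.clusterOf X.1 (G.tail d))]
    · have h2 := G.mem_interfaces_iff (t (G.clusterOf X.1 (G.tail d))) d
      rw [ht] at h2
      have h4 := Int.units_ne_iff_eq_neg.1
        (h2.1 ⟨(G.mem_clusterEdges_iff d).2 ⟨hodd.pos, rfl⟩, hodd⟩)
      rw [G.outerSpin_eq_mul hs (ho _) (ht _) rfl (Or.inl ⟨d, rfl, rfl⟩), LabelledCurrent.spin]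
      set a := s (G.left (dartRev E d))
      set b := t (G.clusterOf X.1 (G.tail d)) (G.left (dartRev E d))
      rw [h3, h4]
      have hb : ((b : ℤ) : ℝ) * ((b : ℤ) : ℝ) = 1 := by
        rw [← Int.cast_mul, ← Units.val_mul, Int.units_mul_self]
        simp
      push_cast
      linear_combination (((X.2 (G.clusterOf X.1 (G.tail d)) : ℤ) : ℝ) * ((a : ℤ) : ℝ)) * hb
    · intro C _ hC
      have h2 := G.mem_interfaces_iff (t C) d
      rw [ht] at h2
      have h4 := not_not.1 (mt h2.2 fun h => hC ((G.mem_clusterEdges_iff d).1 h.1).2.symm)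
      rw [h4, sub_self]
    · simp
  · have h3 := not_not.1 (mt h1.2 hodd)
    rw [h3, sub_self, mul_zero, zero_mul]
    refine Finset.sum_eq_zero fun C _ => ?_
    have h2 := G.mem_interfaces_iff (t C) d
    rw [ht] at h2
    have h4 := not_not.1 (mt h2.2 fun h => hodd h.2)
    rw [h4, sub_self]

/-- The outer spin of the cluster of `g` is `s o`. The factor `-s o` therefore turns its term `1/2 -
1{odd}` into the usual nesting term plus a constant. -/
theorem wiredNestingField_wiredTwist (G : PlaneGraph V E U) (X : G.LabelledCurrent) {s : U → ℤˣ}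
    (hs : {e | Odd (X.1 e)} = G.interfaces s) {g : V} {o : U} (hg : G.Incident g o) (u : U) :
    G.wiredNestingField g o (G.wiredTwist g (-s o) o s X) u =
      -(1 / 2) * ((s o : ℤ) : ℝ) * ((X.spin g : ℤ) : ℝ) +
        G.nestingField o (G.twist o s X) u := by
  classical
  have h1 : s o = G.outerSpin o X.1 s (G.clusterOf X.1 g) :=
    G.outerSpin_eq hs ⟨⟨g, rfl, hg⟩, SimpleGraph.Reachable.refl _⟩
  rw [twist, wiredTwist, nestingField_mk, wiredNestingField_mk, if_pos rfl,
    ← Finset.add_sum_erase _ _ (Finset.mem_univ (G.clusterOf X.1 g)), ← h1,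
    LabelledCurrent.spin, ← Finset.filter_ne' Finset.univ (G.clusterOf X.1 g)]
  rw [Finset.sum_congr rfl fun C hC => by rw [if_neg (Finset.mem_filter.1 hC).2]]
  push_cast
  split_ifs <;> ring

/-- The relation between the height functions on the faces and on the vertices. -/
theorem nestingField_corner (G : PlaneGraph V E U) (X : G.LabelledCurrent)
    (Y : G.dual.LabelledCurrent) (hX : {e | Odd (X.1 e)} = G.interfaces Y.spin)
    (hY : {e | Odd (Y.1 e)} = G.dual.interfaces X.spin) {g : U} {v₀ : V}
    (hv₀ : G.Incident v₀ g) {v : V} {u : U} (hvu : G.Incident v u) :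
    -G.nestingField g (G.twist g Y.spin X) u -
        G.dual.wiredNestingField g v₀ (G.dual.wiredTwist g (-X.spin v₀) v₀ X.spin Y) v =
      1 / 2 * ((Y.spin u : ℤ) : ℝ) * ((X.spin v : ℤ) : ℝ) := by
  rw [G.dual.wiredNestingField_wiredTwist Y hY hv₀.dual]
  set N := G.nestingField g (G.twist g Y.spin X)
  set M := G.dual.nestingField v₀ (G.dual.twist v₀ X.spin Y)
  -- The increments of `N` and `M` make this defect constant over corners. At `(v₀, g)` both fields
  -- vanish, and what remains is cancelled by the constant in the wired field.
  let D : V → U → ℝ := fun v u => -N u - M v - 1 / 2 * ((Y.spin u : ℤ) : ℝ) * ((X.spin v : ℤ) : ℝ)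
  have hN : ∀ d, N (G.left d) - N (G.left (dartRev E d)) = _ := G.nestingField_sub X hX g
  have hM : ∀ d, M (G.tail (dartRev E d)) - M (G.tail d) = _ := fun d => by
    have := G.dual.nestingField_sub Y hY v₀ (dartRev E d)
    simpa only [dual_left, dual_tail, dartRev_dartRev] using this
  have h0 : D v u = D v₀ g := by
    cases isEmpty_or_nonempty E with
    | inl hE =>
      obtain ⟨h1, h2⟩ := G.subsingleton_of_isEmpty
      rw [Subsingleton.elim u g, Subsingleton.elim v v₀]
    | inr hE =>
      obtain ⟨d, rfl, rfl⟩ := hvu.resolve_right (not_isEmpty_of_nonempty E)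
      obtain ⟨d', rfl, rfl⟩ := hv₀.resolve_right (not_isEmpty_of_nonempty E)
      refine G.eq_of_dart_invariant (fun d => D (G.tail d) (G.left d)) (fun d => ?_)
        (fun d => ?_) d d'
      · simp only [tail_rot_inv, left_rot_inv, D]
        linear_combination hN d
      · have h1 := hN (dartRev E d)
        simp only [dartRev_dartRev] at h1
        simp only [D]
        linear_combination -h1 - hM d
  have h1 : N g = 0 := G.nestingField_self g _
  have h2 : M v₀ = 0 := G.dual.nestingField_self v₀ _
  simp only [D, h1, h2] at h0
  linear_combination h0

end Height

end PlaneGraph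

/-! ### Product sums and laws known up to a constant -/

theorem ENNReal.tsum_pi_prod {ι κ : Type*} [Fintype ι] (F : ι → κ → ℝ≥0∞) :
    ∑' f : ι → κ, ∏ i, F i (f i) = ∏ i, ∑' k, F i k := by
  refine Fintype.induction_empty_option (P := fun ι _ => ∀ F : ι → κ → ℝ≥0∞,
    ∑' f : ι → κ, ∏ i, F i (f i) = ∏ i, ∑' k, F i k) ?_ ?_ ?_ ι F
  · intro α β _ e ih F
    let _ : Fintype α := Fintype.ofEquiv β e.symm
    rw [← e.prod_comp, ← ih, ← (e.arrowCongr (Equiv.refl κ)).tsum_eq]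
    refine tsum_congr fun f => ?_
    rw [← e.prod_comp]
    simp
  · simp
  · intro α _ ih F
    rw [Fintype.prod_option, ← ih, ← (Equiv.piOptionEquivProd (β := fun _ => κ)).symm.tsum_eq,
      ENNReal.tsum_prod']
    simp_rw [Fintype.prod_option]
    simp [Equiv.piOptionEquivProd, ENNReal.tsum_mul_left, ENNReal.tsum_mul_right]

/-- Total mass one forces both constants to be the inverse of the sum of `f`, so no partition
function has to be computed. -/
theorem PMF.eq_of_proportional {α : Type*} {p q : PMF α} {f : α → ℝ≥0∞} {c c' : ℝ≥0∞}
    (hp : ∀ x, p x = c * f x) (hq : ∀ x, q x = c' * f x) : p = q := by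
  have h1 := p.tsum_coe
  have h2 := q.tsum_coe
  simp_rw [hp, ENNReal.tsum_mul_left] at h1
  simp_rw [hq, ENNReal.tsum_mul_left] at h2
  ext x
  rw [hp, hq, ENNReal.eq_inv_of_mul_eq_one_left h1, ENNReal.eq_inv_of_mul_eq_one_left h2]

theorem PMF.map_apply_eq_tsum {α β γ : Type*} (p : PMF α) (g : α → β) (b : β) (e : γ → α)
    (he : Function.Injective e) (h₁ : ∀ c, g (e c) = b)
    (h₂ : ∀ a, p a ≠ 0 → g a = b → a ∈ Set.range e) : p.map g b = ∑' c, p (e c) := by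
  classical
  rw [PMF.map_apply, ← he.tsum_eq]
  · exact tsum_congr fun c => if_pos (h₁ c).symm
  · intro a ha
    rw [Function.mem_support, ne_eq, ite_eq_right_iff, Classical.not_imp] at ha
    exact h₂ a ha.2 ha.1.symm

namespace PlaneGraph

variable {V E U : Type*}

/-! ### The labelled double current as a product weight -/

section LabelledLaw

variable [Fintype E]

theorem Sourceless.add_iff {G : PlaneGraph V E U} {m n : E → ℕ} (h : G.Sourceless (m + n)) :
    G.Sourceless m ↔ G.Sourceless n := by
  refine forall_congr' fun v => ?_
  have := h v
  simp only [Pi.add_apply, Finset.sum_add_distrib] at this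
  exact Nat.even_add.1 this

theorem Sourceless.add {G : PlaneGraph V E U} {m n : E → ℕ} (hm : G.Sourceless m)
    (hn : G.Sourceless n) : G.Sourceless (m + n) := by
  intro v
  simp only [Pi.add_apply, Finset.sum_add_distrib]
  exact (hm v).add (hn v)

theorem currentWeight_mul_currentWeight (β : ℝ) (J : E → ℝ) {m n : E → ℕ} (h : m ≤ n) :
    currentWeight β J m * currentWeight β J (n - m) =
      currentWeight β J n * ∏ e, ((n e).choose (m e) : ℝ) := by
  simp only [currentWeight, ← Finset.prod_mul_distrib]
  refine Finset.prod_congr rfl fun e _ => ?_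
  rw [Nat.cast_choose ℝ (h e), Pi.sub_apply]
  have h1 : ((n e).factorial : ℝ) ≠ 0 := by positivity
  have h2 : ((m e).factorial : ℝ) ≠ 0 := by positivity
  have h3 : ((n e - m e).factorial : ℝ) ≠ 0 := by positivity
  field_simp
  rw [← pow_add, Nat.add_sub_cancel' (h e)]

theorem currentWeight_nonneg {β : ℝ} {J : E → ℝ} (h : ∀ e, 0 ≤ β * J e) (n : E → ℕ) :
    0 ≤ currentWeight β J n :=
  Finset.prod_nonneg fun e _ => div_nonneg (pow_nonneg (h e) _) (Nat.cast_nonneg _)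

theorem currentWeight_two_mul (β : ℝ) (J : E → ℝ) (n : E → ℕ) :
    currentWeight (2 * β) J n = 2 ^ (∑ e, n e) * currentWeight β J n := by
  simp only [currentWeight, ← Finset.prod_pow_eq_pow_sum, ← Finset.prod_mul_distrib]
  refine Finset.prod_congr rfl fun e _ => ?_
  rw [mul_assoc, mul_pow, mul_div_assoc]

variable [Fintype V]

open Classical in
-- Splitting `n` into two currents gives binomial factors, which count even subgraphs of the
-- multigraph `n`; the resulting `2 ^ |n|` is absorbed by doubling `β`.
theorem sum_sourcelessWeight_mul (G : PlaneGraph V E U) {β : ℝ} {J : E → ℝ}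
    (h : ∀ e, 0 ≤ β * J e) (n : E → ℕ) :
    ∑ m ∈ Fintype.piFinset (fun e => Finset.range (n e + 1)),
        G.sourcelessWeight β J m * G.sourcelessWeight β J (n - m) =
      (2 ^ Fintype.card V)⁻¹ *
        (G.sourcelessWeight (2 * β) J n * 2 ^ Fintype.card (G.Cluster n)) := by
  have hle : ∀ m ∈ Fintype.piFinset (fun e => Finset.range (n e + 1)), m ≤ n := fun m hm e =>
    Nat.lt_succ_iff.1 (Finset.mem_range.1 (Fintype.mem_piFinset.1 hm e))
  by_cases hn : G.Sourceless n
  · have h1 : ∀ m ∈ Fintype.piFinset (fun e => Finset.range (n e + 1)),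
        G.sourcelessWeight β J m * G.sourcelessWeight β J (n - m) =
          ENNReal.ofReal (currentWeight β J n) *
            ((if G.Sourceless m then ∏ e, (n e).choose (m e) else 0 : ℕ) : ℝ≥0∞) := by
      intro m hm
      have h2 : m + (n - m) = n := add_tsub_cancel_of_le (hle m hm)
      have h3 : G.Sourceless m ↔ G.Sourceless (n - m) := Sourceless.add_iff (h2.symm ▸ hn)
      by_cases hs : G.Sourceless m
      · rw [sourcelessWeight, if_pos hs, sourcelessWeight, if_pos (h3.1 hs), if_pos hs,
          ← ENNReal.ofReal_mul (currentWeight_nonneg h m),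
          currentWeight_mul_currentWeight β J (hle m hm),
          ENNReal.ofReal_mul (currentWeight_nonneg h n), ← Nat.cast_prod, ENNReal.ofReal_natCast]
      · rw [sourcelessWeight, if_neg hs, if_neg hs]
        simp
    rw [Finset.sum_congr rfl h1, ← Finset.mul_sum, ← Nat.cast_sum, sourcelessWeight, if_pos hn,
      currentWeight_two_mul, ENNReal.ofReal_mul (by positivity)]
    have h4 := congrArg (Nat.cast (R := ℝ≥0∞)) (G.sum_choose_sourceless n)
    rw [ENNReal.ofReal_pow zero_le_two, ENNReal.ofReal_ofNat,
      mul_right_comm (2 ^ (∑ e, n e) : ℝ≥0∞)]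
    simp only [Nat.cast_mul, Nat.cast_pow, Nat.cast_ofNat] at h4
    rw [← h4, mul_assoc, ← mul_assoc, ENNReal.inv_mul_cancel (by simp) (by simp), one_mul, mul_comm]
  · rw [sourcelessWeight, if_neg hn, zero_mul, mul_zero]
    refine Finset.sum_eq_zero fun m hm => ?_
    have h2 : m + (n - m) = n := add_tsub_cancel_of_le (hle m hm)
    unfold sourcelessWeight
    split_ifs with h3 h4
    · exact absurd (h2 ▸ h3.add h4) hn
    all_goals simp

theorem doubleCurrentLaw_apply (G : PlaneGraph V E U) {β : ℝ} {J : E → ℝ}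
    (h : ∀ e, 0 ≤ β * J e) (n : E → ℕ) :
    G.doubleCurrentLaw β J n =
      ((∑' m, G.sourcelessWeight β J m)⁻¹ * (∑' m, G.sourcelessWeight β J m)⁻¹ *
          (2 ^ Fintype.card V)⁻¹) *
        (G.sourcelessWeight (2 * β) J n * 2 ^ Fintype.card (G.Cluster n)) := by
  classical
  rw [mul_assoc, ← G.sum_sourcelessWeight_mul h, Finset.mul_sum, doubleCurrentLaw, PMF.bind_apply]
  rw [tsum_eq_sum (s := Fintype.piFinset fun e => Finset.range (n e + 1))]
  · refine Finset.sum_congr rfl fun m hm => ?_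
    have hle : m ≤ n := fun e => Nat.lt_succ_iff.1 (Finset.mem_range.1 (Fintype.mem_piFinset.1 hm e))
    rw [PMF.map_apply, tsum_eq_single (n - m), if_pos (add_tsub_cancel_of_le hle).symm, currentLaw,
      PMF.normalize_apply, PMF.normalize_apply]
    · ring
    · intro m' hm'
      refine if_neg fun heq => hm' ?_
      rw [heq, add_tsub_cancel_left]
  · intro m hm
    rw [PMF.map_apply, ENNReal.tsum_eq_zero.2, mul_zero]
    intro m'
    refine if_neg fun heq => hm (Fintype.mem_piFinset.2 fun e => Finset.mem_range.2 ?_)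
    rw [heq, Pi.add_apply]
    omega

/-- The law of the labelled double random current is proportional to a product weight. -/
theorem exists_labelledDoubleCurrentLaw_apply (G : PlaneGraph V E U) {β : ℝ} {J : E → ℝ}
    (h : ∀ e, 0 ≤ β * J e) :
    ∃ c, ∀ X, G.labelledDoubleCurrentLaw β J X = c * G.sourcelessWeight (2 * β) J X.1 := by
  classical
  refine ⟨(∑' m, G.sourcelessWeight β J m)⁻¹ * (∑' m, G.sourcelessWeight β J m)⁻¹ *
    (2 ^ Fintype.card V)⁻¹, fun X => ?_⟩
  obtain ⟨n, l⟩ := X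
  rw [labelledDoubleCurrentLaw, PMF.bind_apply, tsum_eq_single n]
  -- The factor `2 ^ #clusters` cancels the probability of one labelling.
  · rw [PMF.map_apply, tsum_eq_single l, if_pos rfl, PMF.uniformOfFintype_apply,
      G.doubleCurrentLaw_apply h, Fintype.card_fun, Fintype.card_units_int]
    simp only [mul_assoc]
    rw [Nat.cast_pow, Nat.cast_ofNat, ENNReal.mul_inv_cancel (by simp) (by simp), mul_one]
    intro l' hl'
    exact if_neg fun heq => hl' (eq_of_heq (Sigma.mk.inj heq).2).symm
  · intro m hm
    rw [PMF.map_apply, ENNReal.tsum_eq_zero.2, mul_zero]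
    exact fun l' => if_neg fun heq => hm (Sigma.mk.inj heq).1.symm

end LabelledLaw

/-! ### Kramers–Wannier duality and the coupling on one edge -/

section EdgeWeight

theorem tsum_eq_zero_add_tsum_ite (f : ℕ → ℝ≥0∞) :
    ∑' k, f k = f 0 + ∑' k, if k = 0 then 0 else f k := by
  rw [ENNReal.tsum_eq_add_tsum_ite 0]
  congr 1
  refine tsum_congr fun k => ?_
  split_ifs <;> rfl

theorem tsum_ite_zero (x : ℝ≥0∞) (f : ℕ → ℝ≥0∞) :
    ∑' k, (if k = 0 then x else f k) = x + ∑' k, if k = 0 then 0 else f k := by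
  rw [tsum_eq_zero_add_tsum_ite, if_pos rfl]
  congr 1
  refine tsum_congr fun k => ?_
  split_ifs <;> rfl

open Classical in
/-- The weight of the current `k` on an edge, when `p` says that the spins differ at the two ends
of the edge, and `q` says that the spins differ on its two sides. -/
def edgeWeight (a : ℝ) (p q : Prop) (k : ℕ) : ℝ≥0∞ :=
  if (Odd k ↔ q) ∧ (p → k = 0) then ENNReal.ofReal (a ^ k / k.factorial) else 0

theorem hasSum_odd_sinh (a : ℝ) :
    HasSum (fun k : ℕ => if Odd k then a ^ k / k.factorial else 0) (Real.sinh a) := by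
  have hinj : Function.Injective fun k : ℕ => 2 * k + 1 := fun k l h => by
    simpa using h
  rw [← hinj.hasSum_iff]
  · convert Real.hasSum_sinh a using 2 with k
    exact if_pos (odd_two_mul_add_one k)
  · intro k hk
    exact if_neg fun ⟨l, hl⟩ => hk ⟨l, hl.symm⟩

theorem hasSum_even_cosh (a : ℝ) :
    HasSum (fun k : ℕ => if Even k then a ^ k / k.factorial else 0) (Real.cosh a) := by
  have hinj : Function.Injective fun k : ℕ => 2 * k := fun k l h => by
    simpa using h
  rw [← hinj.hasSum_iff]
  · convert Real.hasSum_cosh a using 2 with k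
    exact if_pos (even_two_mul k)
  · intro k hk
    exact if_neg fun h => hk ⟨k / 2, Nat.two_mul_div_two_of_even h⟩

variable {a b : ℝ}

theorem edgeWeight_both (p q : Prop) (hp : p) (hq : q) (k : ℕ) : edgeWeight a p q k = 0 := by
  refine if_neg fun ⟨h1, h2⟩ => ?_
  have h3 := h1.2 hq
  rw [h2 hp] at h3
  simp at h3

theorem edgeWeight_left (p q : Prop) (hp : p) (hq : ¬q) (k : ℕ) :
    edgeWeight a p q k = if k = 0 then 1 else 0 := by
  by_cases hk : k = 0 <;> simp [edgeWeight, hp, hq, hk]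

theorem tsum_edgeWeight_right (ha : 0 ≤ a) (p q : Prop) (hp : ¬p) (hq : q) :
    ∑' k, edgeWeight a p q k = ENNReal.ofReal (Real.sinh a) := by
  rw [← (hasSum_odd_sinh a).tsum_eq, ENNReal.ofReal_tsum_of_nonneg _ (hasSum_odd_sinh a).summable]
  · refine tsum_congr fun k => ?_
    by_cases hk : Odd k
    · simp [edgeWeight, hp, hq, hk]
    · simp [edgeWeight, hp, hq, hk]
  · intro k
    positivity

theorem tsum_edgeWeight_none (ha : 0 ≤ a) (p q : Prop) (hp : ¬p) (hq : ¬q) :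
    ∑' k, edgeWeight a p q k = ENNReal.ofReal (Real.cosh a) := by
  rw [← (hasSum_even_cosh a).tsum_eq,
    ENNReal.ofReal_tsum_of_nonneg _ (hasSum_even_cosh a).summable]
  · refine tsum_congr fun k => ?_
    by_cases hk : Even k <;> simp [edgeWeight, hp, hq, hk]
  · intro k
    positivity

theorem tsum_edgeWeight_ne_top (ha : 0 ≤ a) (p q : Prop) : ∑' k, edgeWeight a p q k ≠ ∞ := by
  by_cases hp : p <;> by_cases hq : q
  · simp [edgeWeight_both p q hp hq]
  · simp [edgeWeight_left p q hp hq]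
  · rw [tsum_edgeWeight_right ha p q hp hq]
    exact ENNReal.ofReal_ne_top
  · rw [tsum_edgeWeight_none ha p q hp hq]
    exact ENNReal.ofReal_ne_top

theorem edgeWeight_none_zero (p q : Prop) (hq : ¬q) : edgeWeight a p q 0 = 1 := by
  simp [edgeWeight, hq]

theorem tsum_edgeWeight_none_pos (ha : 0 ≤ a) (p q : Prop) (hp : ¬p) (hq : ¬q) :
    ∑' k, (if k = 0 then 0 else edgeWeight a p q k) = ENNReal.ofReal (Real.cosh a - 1) := by
  have h1 := tsum_edgeWeight_none ha p q hp hq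
  rw [tsum_eq_zero_add_tsum_ite, edgeWeight_none_zero p q hq] at h1
  have h2 : ENNReal.ofReal (Real.cosh a) = 1 + ENNReal.ofReal (Real.cosh a - 1) := by
    rw [← ENNReal.ofReal_one, ← ENNReal.ofReal_add zero_le_one
      (sub_nonneg.2 (Real.one_le_cosh a)), add_sub_cancel]
  rw [h2] at h1
  exact (ENNReal.add_right_inj ENNReal.one_ne_top).1 h1

/-- After squaring: `sinh² a * cosh² b = sinh² a + 1 = cosh² a`. -/
theorem sinh_mul_cosh_of_dual (ha : 0 < a) (h : Real.sinh a * Real.sinh b = 1) :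
    Real.sinh a * Real.cosh b = Real.cosh a := by
  have h1 := Real.sinh_pos_iff.2 ha
  have h2 := Real.cosh_pos a
  have h3 := Real.cosh_pos b
  refine (pow_left_inj₀ (by positivity) h2.le two_ne_zero).1 ?_
  rw [mul_pow, Real.cosh_sq, Real.cosh_sq]
  linear_combination (Real.sinh a * Real.sinh b + 1) * h

/-- The coupling of the currents on an edge and on its dual edge, given the spins. -/
theorem exists_edge_coupling (ha : 0 < a) (hb : 0 < b) (h : Real.sinh a * Real.sinh b = 1) :
    ∃ K : Prop → Prop → ℕ → ℕ → ℝ≥0∞,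
      (∀ p q k, ∑' j, K p q k j = edgeWeight a p q k) ∧
      (∀ p q j, ∑' k, K p q k j = ENNReal.ofReal (Real.sinh a) * edgeWeight b q p j) ∧
      ∀ p q k j, K p q k j ≠ 0 → k = 0 ∨ j = 0 := by
  classical
  have h1 := Real.sinh_pos_iff.2 ha
  let c := ENNReal.ofReal (Real.sinh a)
  -- The total masses of the two marginals agree: `0` if `p` and `q`, `1` if only `p`, `sinh a` if
  -- only `q`, `cosh a` if neither. The coupling lives on the two axes and copies each marginal off
  -- the origin. The origin gets the rest, nonzero only if neither holds: `cosh a - (cosh a - 1) -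
  -- sinh a * (cosh b - 1) = 1 - exp (-a)`.
  refine ⟨fun p q k j => if j = 0 then (if k = 0 then (if p then 0 else if q then 0 else
      ENNReal.ofReal (1 - Real.exp (-a))) else edgeWeight a p q k) else
    (if k = 0 then c * edgeWeight b q p j else 0), fun p q k => ?_, fun p q j => ?_,
    fun p q k j => ?_⟩
  · rw [tsum_ite_zero]
    rcases eq_or_ne k 0 with rfl | hk
    · simp only [if_true, ← mul_ite_zero]
      have h2 : ∀ j, (if j = 0 then 0 else c * edgeWeight b q p j) =
          c * if j = 0 then 0 else edgeWeight b q p j := fun j => by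
        split_ifs <;> simp
      simp_rw [h2, ENNReal.tsum_mul_left]
      by_cases hp : p <;> by_cases hq : q
      · simp [edgeWeight_both, hp, hq]
      · have h3 := tsum_edgeWeight_right hb.le q p hq hp
        rw [tsum_eq_zero_add_tsum_ite] at h3
        have h4 : edgeWeight b q p 0 = 0 := by simp [edgeWeight, hp]
        rw [h4, zero_add] at h3
        rw [h3, if_pos hp, zero_add, ← ENNReal.ofReal_mul h1.le, h, edgeWeight_left p q hp hq]
        simp
      · have h3 : edgeWeight a p q 0 = 0 := by simp [edgeWeight, hq]
        rw [h3, if_neg hp, if_pos hq, zero_add]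
        simp_rw [edgeWeight_left q p hq hp]
        simp
      · rw [tsum_edgeWeight_none_pos hb.le q p hq hp, if_neg hp, if_neg hq,
          edgeWeight_none_zero p q hq, ← ENNReal.ofReal_mul h1.le, ← ENNReal.ofReal_add,
          mul_sub, sinh_mul_cosh_of_dual ha h, mul_one, Real.cosh_eq, Real.sinh_eq]
        · rw [← ENNReal.ofReal_one]
          congr 1
          ring
        · simpa using ha.le
        · exact mul_nonneg h1.le (sub_nonneg.2 (Real.one_le_cosh b))
    · simp [hk]
  · rcases eq_or_ne j 0 with rfl | hj
    · simp only [if_true]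
      rw [tsum_ite_zero]
      by_cases hp : p <;> by_cases hq : q
      · simp [edgeWeight_both, hp, hq]
      · have h3 : edgeWeight b q p 0 = 0 := by simp [edgeWeight, hp]
        rw [h3, if_pos hp, zero_add]
        simp_rw [edgeWeight_left p q hp hq]
        simp
      · have h3 := tsum_edgeWeight_right ha.le p q hp hq
        rw [tsum_eq_zero_add_tsum_ite] at h3
        have h4 : edgeWeight a p q 0 = 0 := by simp [edgeWeight, hq]
        rw [h4, zero_add] at h3
        rw [h3, if_neg hp, if_pos hq, zero_add, edgeWeight_left q p hq hp, if_pos rfl, mul_one]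
      · rw [tsum_edgeWeight_none_pos ha.le p q hp hq, if_neg hp, if_neg hq,
          edgeWeight_none_zero q p hp, ← ENNReal.ofReal_add, mul_one, Real.cosh_eq, Real.sinh_eq]
        · congr 1
          ring
        · simpa using ha.le
        · exact sub_nonneg.2 (Real.one_le_cosh a)
    · simp [hj, c]
  · contrapose!
    rintro ⟨hk, hj⟩
    simp [hk, hj]

/-- `sinh (2y)` is half of `coth x - tanh x`, which is the inverse of `2 sinh x cosh x`. -/
theorem dual_parameters {x y : ℝ} (hx : 0 < x) (h : Real.exp (-2 * y) = Real.tanh x) :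
    0 < 2 * y ∧ Real.sinh (2 * x) * Real.sinh (2 * y) = 1 := by
  have h1 := Real.sinh_pos_iff.2 hx
  have h2 := Real.cosh_pos x
  have h3 : Real.sinh (2 * x) * Real.sinh (2 * y) = 1 := by
    have h4 : Real.exp (2 * y) = (Real.tanh x)⁻¹ := by
      rw [← h, ← Real.exp_neg]
      ring_nf
    have h5 := Real.cosh_sq x
    rw [Real.sinh_two_mul, Real.sinh_eq (2 * y), h4, ← neg_mul, h, Real.tanh_eq_sinh_div_cosh]
    field_simp
    rw [h5]
    ring
  refine ⟨Real.sinh_pos_iff.1 (pos_of_mul_pos_right (h3 ▸ one_pos) ?_), h3⟩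
  exact (Real.sinh_pos_iff.2 (by linarith)).le

end EdgeWeight

end PlaneGraph

theorem PMF.map_congr_of_support {α β : Type*} (p : PMF α) {f g : α → β}
    (h : ∀ a ∈ p.support, f a = g a) : p.map f = p.map g := by
  classical
  ext b
  rw [PMF.map_apply, PMF.map_apply]
  refine tsum_congr fun a => ?_
  by_cases ha : a ∈ p.support
  · rw [h a ha]
  · rw [(p.apply_eq_zero_iff a).2 ha]
    simp

namespace PlaneGraph

variable {V E U : Type*}

/-! ### From spins and a current to the labelled current -/

section SpinCurrent

variable [Fintype E]

/-- The joint weight of spins on the vertices, spins on the faces, and a current. -/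
def spinCurrentWeight (G : PlaneGraph V E U) (β : ℝ) (J : E → ℝ) (σ : V → ℤˣ) (s : U → ℤˣ)
    (n : E → ℕ) : ℝ≥0∞ :=
  ∏ e, edgeWeight (2 * β * J e) (e ∈ G.dual.interfaces σ) (e ∈ G.interfaces s) (n e)

theorem odd_eq_interfaces_of_weight_ne_zero {G : PlaneGraph V E U} {β : ℝ} {J : E → ℝ}
    {σ : V → ℤˣ} {s : U → ℤˣ} {n : E → ℕ} (h : G.spinCurrentWeight β J σ s n ≠ 0) :
    {e | Odd (n e)} = G.interfaces s := by
  ext e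
  have h1 := Finset.prod_ne_zero_iff.1 h e (Finset.mem_univ e)
  by_contra h2
  exact h1 (if_neg fun h3 => h2 h3.1)

theorem spin_rev_of_weight_ne_zero {G : PlaneGraph V E U} {β : ℝ} {J : E → ℝ}
    {σ : V → ℤˣ} {s : U → ℤˣ} {n : E → ℕ} (h : G.spinCurrentWeight β J σ s n ≠ 0) (d : E × Bool)
    (hd : 0 < n d.1) : σ (G.tail (dartRev E d)) = σ (G.tail d) := by
  have h1 := Finset.prod_ne_zero_iff.1 h d.1 (Finset.mem_univ d.1)
  by_contra h2
  exact h1 (if_neg fun h3 => hd.ne' (h3.2 ((G.dual.mem_interfaces_iff σ d).2 (Ne.symm h2))))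

open Classical in
-- For `σ` constant on clusters the constraint along edges is void, so the weight no longer depends
-- on `σ`.
theorem spinCurrentWeight_of_cluster (G : PlaneGraph V E U) {β : ℝ} {J : E → ℝ}
    (h : ∀ e, 0 ≤ β * J e) {σ : V → ℤˣ} {n : E → ℕ}
    (hσ : ∀ d : E × Bool, 0 < n d.1 → σ (G.tail (dartRev E d)) = σ (G.tail d)) (s : U → ℤˣ) :
    G.spinCurrentWeight β J σ s n = if {e | Odd (n e)} = G.interfaces s then
      ENNReal.ofReal (currentWeight (2 * β) J n) else 0 := by
  split_ifs with hs
  · rw [currentWeight, ENNReal.ofReal_prod_of_nonneg]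
    · refine Finset.prod_congr rfl fun e _ => if_pos ⟨?_, fun he => ?_⟩
      · rw [← hs]
        rfl
      · by_contra hne
        exact (G.dual.mem_interfaces_iff σ (e, true)).1 he (hσ (e, true) (Nat.pos_of_ne_zero hne)).symm
    · intro e _
      have := h e
      rw [mul_assoc]
      positivity
  · by_contra hne
    exact hs (odd_eq_interfaces_of_weight_ne_zero hne)

omit [Fintype E] in
theorem clusterOf_out (G : PlaneGraph V E U) {n : E → ℕ} (C : G.Cluster n) :
    G.clusterOf n C.out = C :=
  C.out_eq

omit [Fintype E] in
/-- Spins that are constant on clusters are determined by the signs of the clusters. -/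
theorem spin_out (G : PlaneGraph V E U) {n : E → ℕ} {σ : V → ℤˣ}
    (hσ : ∀ d : E × Bool, 0 < n d.1 → σ (G.tail (dartRev E d)) = σ (G.tail d)) :
    LabelledCurrent.spin (G := G) ⟨n, fun C => σ C.out⟩ = σ :=
  funext fun v => G.eq_of_clusterOf_eq σ hσ (G.clusterOf_out (G.clusterOf n v))

variable [Fintype V] [Fintype U]

/-- If spins and a current are distributed according to `spinCurrentWeight`, then the current with
the spins of its clusters is a labelled double random current, and so it remains when these are
multiplied by signs which depend only on the current and the spins on the faces. -/
theorem map_eq_labelledDoubleCurrentLaw (G : PlaneGraph V E U) {β : ℝ} {J : E → ℝ}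
    (h : ∀ e, 0 ≤ β * J e) (ν : PMF ((V → ℤˣ) × (U → ℤˣ) × (E → ℕ))) {c : ℝ≥0∞}
    (hν : ∀ σ s n, ν (σ, s, n) = c * G.spinCurrentWeight β J σ s n)
    (f : ∀ n, (U → ℤˣ) → G.Cluster n → ℤˣ) :
    ν.map (fun x => (⟨x.2.2, fun C => x.1 C.out * f x.2.2 x.2.1 C⟩ : G.LabelledCurrent)) =
      G.labelledDoubleCurrentLaw β J := by
  classical
  obtain ⟨c', hc'⟩ := G.exists_labelledDoubleCurrentLaw_apply h
  -- The factor `2` counts the two face configurations, `t` and `-t`, with given interfaces.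
  refine PMF.eq_of_proportional (c := c * 2) (fun X => ?_) hc'
  obtain ⟨n, l⟩ := X
  -- Signs are their own inverses, so on the support `s` and the image `(n, l)` determine `σ`.
  rw [PMF.map_apply_eq_tsum ν _ _ (fun s : U → ℤˣ =>
    ((fun v => l (G.clusterOf n v) * f n s (G.clusterOf n v), s, n) :
      (V → ℤˣ) × (U → ℤˣ) × (E → ℕ)))]
  · have h1 : ∀ s, ν (fun v => l (G.clusterOf n v) * f n s (G.clusterOf n v), s, n) =
        c * if {e | Odd (n e)} = G.interfaces s then
          ENNReal.ofReal (currentWeight (2 * β) J n) else 0 := by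
      intro s
      rw [hν, G.spinCurrentWeight_of_cluster h]
      intro d hd
      rw [G.clusterOf_rev hd]
    simp_rw [h1]
    rw [ENNReal.tsum_mul_left, tsum_fintype, ← Finset.sum_filter, Finset.sum_const,
      G.card_odd_eq_interfaces, sourcelessWeight]
    by_cases hn : G.Sourceless n
    · rw [if_pos hn, if_pos hn, two_nsmul, ← two_mul, mul_assoc]
    · rw [if_neg hn, if_neg hn, zero_nsmul, mul_zero, mul_zero]
  · exact fun s s' hs => congrArg (fun x => x.2.1) hs
  · intro s
    refine congrArg (Sigma.mk n) (funext fun C => ?_)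
    dsimp only
    rw [G.clusterOf_out, mul_assoc, Int.units_mul_self, mul_one]
  · rintro ⟨σ, s, m⟩ hne heq
    rw [hν] at hne
    have h1 := G.spin_out (spin_rev_of_weight_ne_zero (right_ne_zero_of_mul hne))
    obtain rfl : m = n := (Sigma.mk.inj heq).1
    have h2 := congrFun (eq_of_heq (Sigma.mk.inj heq).2)
    refine ⟨s, ?_⟩
    refine Prod.ext (funext fun v => ?_) rfl
    dsimp only
    rw [← h2, mul_assoc, Int.units_mul_self, mul_one]
    exact congrFun h1 v

end SpinCurrent

/-! ### The global coupling -/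

section Coupling

variable [Fintype V] [Fintype E] [Fintype U]

/-- The coupling of the spins, the current, and the dual current. -/
theorem exists_spin_coupling (G : PlaneGraph V E U) {β βd : ℝ} {J Jd : E → ℝ}
    (h : ∀ e, 0 < 2 * β * J e) (hd : ∀ e, 0 < 2 * βd * Jd e)
    (hdual : ∀ e, Real.sinh (2 * β * J e) * Real.sinh (2 * βd * Jd e) = 1) :
    ∃ P : PMF ((V → ℤˣ) × (U → ℤˣ) × (E → ℕ) × (E → ℕ)),
      (∃ c, ∀ σ s n, P.map (fun ω => (ω.1, ω.2.1, ω.2.2.1)) (σ, s, n) =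
        c * G.spinCurrentWeight β J σ s n) ∧
      (∃ c, ∀ s σ m, P.map (fun ω => (ω.2.1, ω.1, ω.2.2.2)) (s, σ, m) =
        c * G.dual.spinCurrentWeight βd Jd s σ m) ∧
      ∀ σ s n m, (σ, s, n, m) ∈ P.support → ∀ e, n e = 0 ∨ m e = 0 := by
  classical
  choose K hK₁ hK₂ hK using fun e => exists_edge_coupling (h e) (hd e) (hdual e)
  let W : (V → ℤˣ) × (U → ℤˣ) × (E → ℕ) × (E → ℕ) → ℝ≥0∞ := fun ω =>
    ∏ e, K e (e ∈ G.dual.interfaces ω.1) (e ∈ G.interfaces ω.2.1) (ω.2.2.1 e) (ω.2.2.2 e)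
  have hW₁ : ∀ σ s n, ∑' m, W (σ, s, n, m) = G.spinCurrentWeight β J σ s n := by
    intro σ s n
    rw [ENNReal.tsum_pi_prod fun e j =>
      K e (e ∈ G.dual.interfaces σ) (e ∈ G.interfaces s) (n e) j]
    exact Finset.prod_congr rfl fun e _ => hK₁ e _ _ _
  have hW₂ : ∀ σ s m, ∑' n, W (σ, s, n, m) =
      (∏ e, ENNReal.ofReal (Real.sinh (2 * β * J e))) *
        G.dual.spinCurrentWeight βd Jd s σ m := by
    intro σ s m
    rw [ENNReal.tsum_pi_prod fun e k =>
      K e (e ∈ G.dual.interfaces σ) (e ∈ G.interfaces s) k (m e), spinCurrentWeight,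
      ← Finset.prod_mul_distrib]
    refine Finset.prod_congr rfl fun e _ => ?_
    rw [dual_dual_interfaces]
    exact hK₂ e _ _ _
  have hsum : ∑' ω, W ω = ∑ σ, ∑ s, ∑' n, G.spinCurrentWeight β J σ s n := by
    rw [ENNReal.tsum_prod', tsum_fintype]
    refine Finset.sum_congr rfl fun σ _ => ?_
    rw [ENNReal.tsum_prod', tsum_fintype]
    refine Finset.sum_congr rfl fun s _ => ?_
    rw [ENNReal.tsum_prod']
    exact tsum_congr fun n => hW₁ σ s n
  have hne_top : ∑' ω, W ω ≠ ∞ := by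
    rw [hsum]
    refine ENNReal.sum_ne_top.2 fun σ _ => ENNReal.sum_ne_top.2 fun s _ => ?_
    simp only [spinCurrentWeight]
    rw [ENNReal.tsum_pi_prod fun e k =>
      edgeWeight (2 * β * J e) (e ∈ G.dual.interfaces σ) (e ∈ G.interfaces s) k]
    exact ENNReal.prod_ne_top fun e _ => tsum_edgeWeight_ne_top (h e).le _ _
  have hne_zero : ∑' ω, W ω ≠ 0 := by
    intro h0
    -- All-plus spins have no interfaces, so at zero current every edge factor of the marginal is
    -- `1`.
    have h1 : ∑' m, W (1, 1, 0, m) = 0 :=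
      ENNReal.tsum_eq_zero.2 fun m => ENNReal.tsum_eq_zero.1 h0 (1, 1, 0, m)
    rw [hW₁] at h1
    obtain ⟨e, -, he⟩ := Finset.prod_eq_zero_iff.1 h1
    rw [Pi.zero_apply, edgeWeight_none_zero] at he
    · exact one_ne_zero he
    · simp [interfaces]
  refine ⟨PMF.normalize W hne_zero hne_top, ⟨(∑' ω, W ω)⁻¹, fun σ s n => ?_⟩,
    ⟨(∑' ω, W ω)⁻¹ * ∏ e, ENNReal.ofReal (Real.sinh (2 * β * J e)), fun s σ m => ?_⟩,
    fun σ s n m hω e => ?_⟩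
  · rw [PMF.map_apply_eq_tsum _ _ _ (fun m => (σ, s, n, m))]
    · simp_rw [PMF.normalize_apply]
      rw [ENNReal.tsum_mul_right, hW₁, mul_comm]
    · exact fun m m' hm => congrArg (fun x => x.2.2.2) hm
    · exact fun m => rfl
    · rintro ⟨σ', s', n', m⟩ - heq
      simp only [Prod.mk.injEq] at heq
      obtain ⟨rfl, rfl, rfl⟩ := heq
      exact ⟨m, rfl⟩
  · rw [PMF.map_apply_eq_tsum _ _ _ (fun n => (σ, s, n, m))]
    · simp_rw [PMF.normalize_apply]
      rw [ENNReal.tsum_mul_right, hW₂, mul_comm, mul_assoc]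
    · exact fun m m' hm => congrArg (fun x => x.2.2.1) hm
    · exact fun m => rfl
    · rintro ⟨σ', s', n, m'⟩ - heq
      simp only [Prod.mk.injEq] at heq
      obtain ⟨rfl, rfl, rfl⟩ := heq
      exact ⟨n, rfl⟩
  · have h1 : W (σ, s, n, m) ≠ 0 := (PMF.mem_support_normalize_iff _ _ _).1 hω
    exact hK e _ _ _ _ (Finset.prod_ne_zero_iff.1 h1 e (Finset.mem_univ e))

end Coupling

theorem nestingField_neg [Fintype V] (G : PlaneGraph V E U) (o : U) (n : E → ℕ)
    (l : G.Cluster n → ℤˣ) (u : U) :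
    G.nestingField o ⟨n, fun C => -l C⟩ u = -G.nestingField o ⟨n, l⟩ u := by
  rw [nestingField_mk, nestingField_mk, ← Finset.sum_neg_distrib]
  refine Finset.sum_congr rfl fun C _ => ?_
  split_ifs <;> simp

/-- The wired nesting field on the vertices does not depend on the choice of the external
vertex. -/
theorem wiredNestingField_eq [Fintype V] [Fintype E] [Fintype U] (G : PlaneGraph V E U)
    (X : G.LabelledCurrent) (Y : G.dual.LabelledCurrent)
    (hX : {e | Odd (X.1 e)} = G.interfaces Y.spin)
    (hY : {e | Odd (Y.1 e)} = G.dual.interfaces X.spin) {g : U} {v₀ v₁ : V}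
    (hv₀ : G.Incident v₀ g) (hv₁ : G.Incident v₁ g) (v : V) :
    G.dual.wiredNestingField g v₀ (G.dual.wiredTwist g (-X.spin v₀) v₀ X.spin Y) v =
      G.dual.wiredNestingField g v₁ (G.dual.wiredTwist g (-X.spin v₁) v₁ X.spin Y) v := by
  -- The corner identity recovers the value at `v` from the face field and the spins, none of which
  -- involves the external vertex.
  obtain ⟨u, hu⟩ := G.exists_incident_face v
  linear_combination G.nestingField_corner X Y hX hY hv₁ hu -
    G.nestingField_corner X Y hX hY hv₀ hu

end PlaneGraph

end

/-! ### Assembly of the theorem -/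

theorem theorem2p1 {V E U : Type*} [Fintype V] [Fintype E] [Fintype U]
    (G : PlaneGraph V E U) (g : U) (β βd : ℝ) (J Jd : E → ℝ) (hβ : 0 < β) (hJ : ∀ e, 0 < J e)
    (hdual : ∀ e, Real.exp (-2 * βd * Jd e) = Real.tanh (β * J e)) :
    ∃ μ : PMF (G.LabelledCurrent × G.dual.LabelledCurrent × (V ⊕ U → ℝ)),
      -- the current with its spins, and the dual current with its spins
      μ.map (fun ω => ω.1) = G.labelledDoubleCurrentLaw β J ∧
      μ.map (fun ω => ω.2.1) = G.dual.labelledDoubleCurrentLaw βd Jd ∧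
      -- on faces, the height function has the law of the free nesting field, with these labels
      μ.map (fun ω => G.twist g ω.2.1.spin ω.1) = G.labelledDoubleCurrentLaw β J ∧
      μ.map (fun ω => (ω.1.1, fun u : U => ω.2.2 (.inr u))) =
        (G.labelledDoubleCurrentLaw β J).map (fun X => (X.1, G.nestingField g X)) ∧
      -- on vertices, it has the law of the wired nesting field, with these labels, whichever
      -- vertex `v₀` incident on `g` is taken as the external face of the dual graph
      (∀ v₀, G.Incident v₀ g →
        μ.map (fun ω => G.dual.wiredTwist g 1 v₀ ω.1.spin ω.2.1) =
          G.dual.labelledDoubleCurrentLaw βd Jd ∧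
        μ.map (fun ω => (ω.2.1.1, fun v : V => ω.2.2 (.inl v))) =
          (G.dual.labelledDoubleCurrentLaw βd Jd).map
            (fun Y => (Y.1, G.dual.wiredNestingField g v₀ Y))) ∧
      -- almost sure properties
      ∀ X Y H, (X, Y, H) ∈ μ.support →
        -- odd parts are interfaces
        {e | Odd (X.1 e)} = G.interfaces Y.spin ∧
        {e | Odd (Y.1 e)} = G.dual.interfaces X.spin ∧
        -- increments of the height function
        (∀ v u, G.Incident v u →
          H (.inr u) - H (.inl v) = 1 / 2 * ((Y.spin u : ℤ) : ℝ) * ((X.spin v : ℤ) : ℝ)) ∧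
        -- the two currents are disjoint
        (∀ e, (0 < X.1 e → Y.1 e = 0) ∧ (0 < Y.1 e → X.1 e = 0)) ∧
        -- the dual spin of every cluster of the current is well defined
        (∀ C : G.Cluster X.1,
          (∃ u, G.IncidentOutside g X.1 C u) ∧
          ∀ u, G.IncidentOutside g X.1 C u → Y.spin u = G.outerSpin g X.1 Y.spin C) ∧
        -- the height function on faces is minus the nesting field with the labels above
        (∀ u, H (.inr u) = -G.nestingField g (G.twist g Y.spin X) u) ∧
        ∀ v₀, G.Incident v₀ g →
          -- the dual spin of every cluster of the dual current not containing `g` is well defined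
          (∀ C : G.dual.Cluster Y.1, C ≠ G.dual.clusterOf Y.1 g →
            (∃ v, G.dual.IncidentOutside v₀ Y.1 C v) ∧
            ∀ v, G.dual.IncidentOutside v₀ Y.1 C v →
              X.spin v = G.dual.outerSpin v₀ Y.1 X.spin C) ∧
          -- the height function on vertices is the wired nesting field with the labels above,
          -- except that the label of the cluster of `g` is multiplied by `-X.spin v₀`
          (∀ v, H (.inl v) = G.dual.wiredNestingField g v₀
            (G.dual.wiredTwist g (-X.spin v₀) v₀ X.spin Y) v) := by
  classical
  have hpar : ∀ e, 0 < 2 * (βd * Jd e) ∧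
      Real.sinh (2 * (β * J e)) * Real.sinh (2 * (βd * Jd e)) = 1 := fun e =>
    PlaneGraph.dual_parameters (mul_pos hβ (hJ e)) (by rw [← hdual e, mul_assoc])
  have hpos : ∀ e, 0 ≤ β * J e := fun e => (mul_pos hβ (hJ e)).le
  have hposd : ∀ e, 0 ≤ βd * Jd e := fun e => by linarith [(hpar e).1]
  obtain ⟨P, ⟨c₁, hP₁⟩, ⟨c₂, hP₂⟩, hdisj⟩ := G.exists_spin_coupling (β := β) (βd := βd) (J := J)
    (Jd := Jd) (fun e => by rw [mul_assoc]; exact mul_pos two_pos (mul_pos hβ (hJ e)))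
    (fun e => by rw [mul_assoc]; exact (hpar e).1)
    (fun e => by rw [mul_assoc, mul_assoc]; exact (hpar e).2)
  -- Cluster signs are read at representatives; on the support the spins are constant on clusters,
  -- so nothing is lost.
  let X : (V → ℤˣ) × (U → ℤˣ) × (E → ℕ) × (E → ℕ) → G.LabelledCurrent :=
    fun ω => ⟨ω.2.2.1, fun C => ω.1 C.out⟩
  let Y : (V → ℤˣ) × (U → ℤˣ) × (E → ℕ) × (E → ℕ) → G.dual.LabelledCurrent :=
    fun ω => ⟨ω.2.2.2, fun C => ω.2.1 C.out⟩
  obtain ⟨v₁, hv₁⟩ := G.exists_incident_vertex g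
  -- The height is built from one fixed external vertex `v₁`; `hH` frees it from that choice.
  let H : (V → ℤˣ) × (U → ℤˣ) × (E → ℕ) × (E → ℕ) → V ⊕ U → ℝ := fun ω =>
    Sum.elim (fun v => G.dual.wiredNestingField g v₁
      (G.dual.wiredTwist g (-(X ω).spin v₁) v₁ (X ω).spin (Y ω)) v)
      fun u => -G.nestingField g (G.twist g (Y ω).spin (X ω)) u
  have hlaw₁ : ∀ f : ∀ n, (U → ℤˣ) → G.Cluster n → ℤˣ,
      P.map (fun ω => (⟨ω.2.2.1, fun C => ω.1 C.out * f ω.2.2.1 ω.2.1 C⟩ : G.LabelledCurrent)) =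
        G.labelledDoubleCurrentLaw β J := by
    intro f
    rw [← G.map_eq_labelledDoubleCurrentLaw hpos _ hP₁ f, PMF.map_comp]
    rfl
  have hlaw₂ : ∀ f : ∀ m, (V → ℤˣ) → G.dual.Cluster m → ℤˣ,
      P.map (fun ω =>
        (⟨ω.2.2.2, fun C => ω.2.1 C.out * f ω.2.2.2 ω.1 C⟩ : G.dual.LabelledCurrent)) =
        G.dual.labelledDoubleCurrentLaw βd Jd := by
    intro f
    rw [← G.dual.map_eq_labelledDoubleCurrentLaw hposd _ hP₂ f, PMF.map_comp]
    rfl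
  have hne₁ : ∀ ω ∈ P.support, G.spinCurrentWeight β J ω.1 ω.2.1 ω.2.2.1 ≠ 0 := by
    intro ω hω h0
    have h1 : (ω.1, ω.2.1, ω.2.2.1) ∈
        (P.map fun ω => (ω.1, ω.2.1, ω.2.2.1)).support :=
      (PMF.mem_support_map_iff _ _ _).2 ⟨ω, hω, rfl⟩
    rw [PMF.mem_support_iff, hP₁, h0, mul_zero] at h1
    exact h1 rfl
  have hne₂ : ∀ ω ∈ P.support, G.dual.spinCurrentWeight βd Jd ω.2.1 ω.1 ω.2.2.2 ≠ 0 := by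
    intro ω hω h0
    have h1 : (ω.2.1, ω.1, ω.2.2.2) ∈
        (P.map fun ω => (ω.2.1, ω.1, ω.2.2.2)).support :=
      (PMF.mem_support_map_iff _ _ _).2 ⟨ω, hω, rfl⟩
    rw [PMF.mem_support_iff, hP₂, h0, mul_zero] at h1
    exact h1 rfl
  have hspin₁ : ∀ ω ∈ P.support, (X ω).spin = ω.1 := fun ω hω =>
    G.spin_out (PlaneGraph.spin_rev_of_weight_ne_zero (hne₁ ω hω))
  have hspin₂ : ∀ ω ∈ P.support, (Y ω).spin = ω.2.1 := fun ω hω =>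
    G.dual.spin_out (PlaneGraph.spin_rev_of_weight_ne_zero (hne₂ ω hω))
  have hodd₁ : ∀ ω ∈ P.support, {e | Odd ((X ω).1 e)} = G.interfaces (Y ω).spin := fun ω hω => by
    rw [hspin₂ ω hω]
    exact PlaneGraph.odd_eq_interfaces_of_weight_ne_zero (hne₁ ω hω)
  have hodd₂ : ∀ ω ∈ P.support, {e | Odd ((Y ω).1 e)} = G.dual.interfaces (X ω).spin :=
    fun ω hω => by
      rw [hspin₁ ω hω]
      exact PlaneGraph.odd_eq_interfaces_of_weight_ne_zero (hne₂ ω hω)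
  have hH : ∀ ω ∈ P.support, ∀ v₀, G.Incident v₀ g → ∀ v, H ω (.inl v) =
      G.dual.wiredNestingField g v₀
        (G.dual.wiredTwist g (-(X ω).spin v₀) v₀ (X ω).spin (Y ω)) v := fun ω hω v₀ hv₀ v =>
    G.wiredNestingField_eq (X ω) (Y ω) (hodd₁ ω hω) (hodd₂ ω hω) hv₁ hv₀ v
  refine ⟨P.map fun ω => (X ω, Y ω, H ω), ?_, ?_, ?_, ?_, fun v₀ hv₀ => ⟨?_, ?_⟩, ?_⟩
  · rw [PMF.map_comp, ← hlaw₁ fun _ _ _ => 1]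
    simp only [mul_one]
    rfl
  · rw [PMF.map_comp, ← hlaw₂ fun _ _ _ => 1]
    simp only [mul_one]
    rfl
  · rw [PMF.map_comp, ← hlaw₁ fun n s C => G.outerSpin g n s C]
    refine P.map_congr_of_support fun ω hω => ?_
    simp only [Function.comp_apply, hspin₂ ω hω]
    rfl
  -- The height on faces is minus the nesting field, and the field is odd in the labels; so the law
  -- is that of labels with the opposite twist.
  · rw [PMF.map_comp, ← hlaw₁ fun n s C => -G.outerSpin g n s C, PMF.map_comp]
    refine P.map_congr_of_support fun ω hω => Prod.ext rfl (funext fun u => ?_)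
    simp only [Function.comp_apply, mul_neg, G.nestingField_neg]
    simp only [H, Sum.elim_inr, hspin₂ ω hω]
    rfl
  · rw [PMF.map_comp, ← hlaw₂ fun m σ C =>
      if C = G.dual.clusterOf m g then 1 else G.dual.outerSpin v₀ m σ C]
    refine P.map_congr_of_support fun ω hω => ?_
    simp only [Function.comp_apply, hspin₁ ω hω, PlaneGraph.wiredTwist]
    congr
  -- The sign `-σ v₀` of the ghost label is a function of the primal spins alone, so it too
  -- preserves the law.
  · rw [PMF.map_comp, ← hlaw₂ fun m σ C =>
      if C = G.dual.clusterOf m g then -σ v₀ else G.dual.outerSpin v₀ m σ C, PMF.map_comp]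
    refine P.map_congr_of_support fun ω hω => Prod.ext rfl (funext fun v => ?_)
    simp only [Function.comp_apply]
    rw [hH ω hω v₀ hv₀ v, hspin₁ ω hω, PlaneGraph.wiredTwist]
  · intro X' Y' H' hmem
    obtain ⟨ω, hω, heq⟩ := (PMF.mem_support_map_iff _ _ _).1 hmem
    simp only [Prod.mk.injEq] at heq
    obtain ⟨rfl, rfl, rfl⟩ := heq
    have hd := hdisj _ _ _ _ hω
    refine ⟨hodd₁ ω hω, hodd₂ ω hω, fun v u hvu => ?_, fun e => ⟨fun h => ?_, fun h => ?_⟩,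
      fun C => ⟨G.exists_incidentOutside g _ C, fun u hu => G.outerSpin_eq (hodd₁ ω hω) hu⟩,
      fun u => rfl, fun v₀ hv₀ => ⟨fun C _ => ⟨G.dual.exists_incidentOutside v₀ _ C,
        fun v hv => G.dual.outerSpin_eq (hodd₂ ω hω) hv⟩, hH ω hω v₀ hv₀⟩⟩
    · exact G.nestingField_corner (X ω) (Y ω) (hodd₁ ω hω) (hodd₂ ω hω) hv₁ hvu
    · exact (hd e).resolve_left h.ne'
    · exact (hd e).resolve_right h.ne'
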